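/- **Setting.** Let $X$ be a finite pure $n$-dimensional simplicial complex, $X^{(k)}$ its set of $k$-simplices for $-1\le k\le n$ (with $X^{(-1)}=\{\emptyset\}$), equipped with a weight function: $m(\sigma)>0$ for every simplex $\sigma$ and $m(\tau)=\sum_{\sigma\in X^{(k+1)},\,\tau\subset\sigma}m(\sigma)$ for all $-1\le k\le n-1$, $\tau\in X^{(k)}$. Write $m(X^{(k)})=\sum_{\sigma\in X^{(k)}}m(\sigma)$. The link $X_\tau$ of $\tau\in X^{(j)}$ consists of the simplices $\sigma$ disjoint from $\tau$ with $\tau\cup\sigma$ a simplex of $X$; it is pure of dimension $n-j-1$ and carries the weight $m_\tau(\sigma)=m(\tau\cup\sigma)$; $X_\emptyset=X$. Let $C^k(X,\mathbb F_2)$ be the functions $X^{(k)}\to\mathbb F_2$, $d\phi(\eta)=\sum_{\sigma\in X^{(k)},\,\sigma\subset\eta}\phi(\sigma)$ for $\eta\in X^{(k+1)}$, $B^k(X,\mathbb F_2)=d\,C^{k-1}(X,\mathbb F_2)$ for $k\ge 0$, and $\|\phi\|=\sum_{\phi(\sigma)=1}m(\sigma)$. For $\phi\in C^k(X,\mathbb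 F_2)$ and $\tau\in X^{(j)}$ with $j<k$ let $\phi_\tau\in C^{k-j-1}(X_\tau,\mathbb F_2)$, $\phi_\tau(\sigma)=\phi(\tau\cup\sigma)$. The $1$-coboundary expansion is $$\epsilon_1(X)=\min\Big\{\frac{\|d\phi\|}{\min_{\psi\in B^1(X,\mathbb F_2)}\|\phi-\psi\|}:\ \phi\in C^1(X,\mathbb F_2)\setminus B^1(X,\mathbb F_2)\Big\}.$$ For $\varepsilon'>0$, a cochain $\phi\in C^0(X,\mathbb F_2)$ is $\varepsilon'$-locally minimal if $\|\phi\|\le\frac{1+\varepsilon'}{2}m(X^{(0)})$; for $k\ge1$, $\phi\in C^k(X,\mathbb F_2)$ is $\varepsilon'$-locally minimal if $\|\phi_\tau\|\le\|\phi_\tau-\psi\|+\varepsilon' m(\tau)$ for all $0\le j\le k-1$, $\tau\in X^{(j)}$ and $\psi\in B^{k-j-1}(X_\tau,\mathbb F_2)$. Let $\lambda(X)$ be the smallest positive eigenvalue of the weighted graph Laplacian $\Delta\phi(v)=\phi(v)-\frac1{m(v)}\sum_{u:\{u,v\}\in X^{(1)}}m(\{u,v\})\phi(u)$ of the $1$-skeleton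 of $X$. For $\frac{n-1}n<\lambda\le1$, $X$ has $\lambda$-local spectral expansion if all links of $X$ of dimension $>0$ (including $X$ itself) are connected and $\lambda(X_\tau)\ge\lambda$ for every one-dimensional link $X_\tau$, i.e. for every $\tau\in X^{(n-2)}$. **Theorem 7.11.** For every $n>2$ and $\epsilon>0$ there are constants $\frac{n-1}{n}<\Lambda_2<1$ and $\varepsilon',C_1,C_2>0$ such that for every finite pure $n$-dimensional weighted simplicial complex $X$ with $\lambda$-local spectral expansion, if $\lambda\ge\Lambda_2$ and $\epsilon_1(X_{\{v\}})\ge\epsilon$ for every $\{v\}\in X^{(0)}$, then: 1. for every $0\ne\phi\in C^0(X,\mathbb F_2)$ that is $\varepsilon'$-locally minimal, $\|d\phi\|>0$; 2. for every $0\ne\phi\in C^1(X,\mathbb F_2)$ that is $\varepsilon'$-locally minimal with $\|\phi\|\le C_1\,m(X^{(1)})$, $\|d\phi\|\ge\frac14\|\phi\|>0$; 3. for every $0\ne\phi\in C^2(X,\mathbb F_2)$ that is $\varepsilon'$-locally minimal with $\|\phi\|\le C_2\,m(X^{(2)})$, $\|d\phi\|\ge\frac{3\epsilon}{10}\|\phi\|>0$.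 -/

import Mathlib

/-- A finite pure weighted simplicial complex with vertices in `V`.
`rank` is the number of vertices of a maximal simplex, so that the complex is pure of dimension
`rank - 1`. The empty set is a simplex (of dimension `-1`). The weight function is positive on
simplices, and the weight of a non-maximal simplex `τ` is the sum of the weights of the simplices
that contain `τ` and have exactly one vertex more. The values of `weight` on sets that are not
simplices play no role. -/
structure WeightedComplex (V : Type*) [DecidableEq V] where
  faces : Finset (Finset V)
  rank : ℕ
  weight : Finset V → ℝ
  empty_mem : ∅ ∈ faces
  down_closed : ∀ σ ∈ faces, ∀ τ, τ ⊆ σ → τ ∈ faces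
  pure : ∀ σ ∈ faces, ∃ η ∈ faces, σ ⊆ η ∧ η.card = rank
  weight_pos : ∀ σ ∈ faces, 0 < weight σ
  weight_sum : ∀ τ ∈ faces, τ.card < rank →
    weight τ = ∑ σ ∈ faces.filter (fun σ => τ ⊆ σ ∧ σ.card = τ.card + 1), weight σ

namespace WeightedComplex

variable {V : Type*} [DecidableEq V]

/-- The simplices with `r` vertices, that is, the set `X^{(r-1)}` of simplices of dimension
`r - 1`. -/
def cells (X : WeightedComplex V) (r : ℕ) : Finset (Finset V) :=
  X.faces.filter (fun σ => σ.card = r)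

theorem mem_cells {X : WeightedComplex V} {r : ℕ} {σ : Finset V} :
    σ ∈ X.cells r ↔ σ ∈ X.faces ∧ σ.card = r := by
  simp [cells]

/-- `m(X^{(r-1)})`, the total weight of the simplices with `r` vertices. -/
def totalWeight (X : WeightedComplex V) (r : ℕ) : ℝ := ∑ σ ∈ X.cells r, X.weight σ

/-- The link `X_τ` of a simplex `τ`: the simplices disjoint from `τ` whose union with `τ` is a
simplex, with the weight `m_τ(σ) = m(τ ∪ σ)`. It is pure of dimension `(rank - |τ|) - 1`. -/
def link (X : WeightedComplex V) (τ : Finset V) (hτ : τ ∈ X.faces) : WeightedComplex V where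
  faces := X.faces.filter (fun σ => Disjoint τ σ ∧ τ ∪ σ ∈ X.faces)
  rank := X.rank - τ.card
  weight := fun σ => X.weight (τ ∪ σ)
  empty_mem := by simp [X.empty_mem, hτ]
  down_closed := by
    intro σ hσ ρ hρ
    rw [Finset.mem_filter] at hσ ⊢
    exact ⟨X.down_closed _ hσ.1 _ hρ, hσ.2.1.mono_right hρ,
      X.down_closed _ hσ.2.2 _ (Finset.union_subset_union_right hρ)⟩
  pure := by
    intro σ hσ
    rw [Finset.mem_filter] at hσ
    obtain ⟨η, hη, hsub, hcard⟩ := X.pure _ hσ.2.2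
    have hτη : τ ⊆ η := Finset.subset_union_left.trans hsub
    refine ⟨η \ τ, ?_, ?_, ?_⟩
    · rw [Finset.mem_filter, Finset.union_sdiff_of_subset hτη]
      exact ⟨X.down_closed _ hη _ Finset.sdiff_subset, Finset.disjoint_sdiff, hη⟩
    · intro x hx
      rw [Finset.mem_sdiff]
      exact ⟨hsub (Finset.mem_union_right _ hx),
        fun h => (Finset.disjoint_left.mp hσ.2.1 h hx)⟩
    · rw [Finset.card_sdiff_of_subset hτη, hcard]
  weight_pos := by
    intro σ hσ
    rw [Finset.mem_filter] at hσ
    exact X.weight_pos _ hσ.2.2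
  weight_sum := by
    intro σ hσ hlt
    rw [Finset.mem_filter] at hσ
    obtain ⟨-, hdis, hmem⟩ := hσ
    have hc : (τ ∪ σ).card = τ.card + σ.card := Finset.card_union_of_disjoint hdis
    rw [X.weight_sum _ hmem (by omega)]
    symm
    refine Finset.sum_bij' (fun ρ _ => τ ∪ ρ) (fun ρ _ => ρ \ τ) ?_ ?_ ?_ ?_ ?_
    · intro ρ hρ
      simp only [Finset.mem_filter] at hρ ⊢
      obtain ⟨⟨h1, h2, h3⟩, h4, h5⟩ := hρ
      refine ⟨h3, Finset.union_subset_union_right h4, ?_⟩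
      rw [Finset.card_union_of_disjoint h2]
      omega
    · intro ρ hρ
      simp only [Finset.mem_filter] at hρ ⊢
      obtain ⟨h1, h2, h3⟩ := hρ
      have hτρ : τ ⊆ ρ := Finset.subset_union_left.trans h2
      refine ⟨⟨X.down_closed _ h1 _ Finset.sdiff_subset, Finset.disjoint_sdiff, ?_⟩, ?_, ?_⟩
      · rwa [Finset.union_sdiff_of_subset hτρ]
      · intro x hx
        rw [Finset.mem_sdiff]
        exact ⟨h2 (Finset.mem_union_right _ hx), fun h => Finset.disjoint_left.mp hdis h hx⟩
      · rw [Finset.card_sdiff_of_subset hτρ]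
        omega
    · intro ρ hρ
      simp only [Finset.mem_filter] at hρ
      exact Finset.union_sdiff_cancel_left hρ.1.2.1
    · intro ρ hρ
      simp only [Finset.mem_filter] at hρ
      exact Finset.union_sdiff_of_subset (Finset.subset_union_left.trans hρ.2.1)
    · intro ρ _
      rfl

/-! ### Cochains with coefficients in the field with two elements -/

/-- `C^{r-1}(X, 𝔽₂)`: the functions from the simplices with `r` vertices to `𝔽₂`. -/
abbrev Cochain (X : WeightedComplex V) (r : ℕ) : Type _ := {σ // σ ∈ X.cells r} → ZMod 2

/-- The differential `C^{r-1}(X, 𝔽₂) → C^r(X, 𝔽₂)`: the value of `dφ` on a simplex is the sum of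
the values of `φ` on its facets. -/
def d (X : WeightedComplex V) (r : ℕ) : X.Cochain r →ₗ[ZMod 2] X.Cochain (r + 1) where
  toFun φ := fun σ => ∑ τ : {τ // τ ∈ X.cells r}, if τ.1 ⊆ σ.1 then φ τ else 0
  map_add' φ ψ := by
    ext σ
    simp only [Pi.add_apply, ← Finset.sum_add_distrib]
    refine Finset.sum_congr rfl fun τ _ => ?_
    split_ifs <;> simp
  map_smul' a φ := by
    ext σ
    simp only [Pi.smul_apply, smul_eq_mul, RingHom.id_apply, Finset.mul_sum]
    refine Finset.sum_congr rfl fun τ _ => ?_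
    split_ifs <;> simp

/-- The coboundaries `B^k(X, 𝔽₂) ⊆ C^k(X, 𝔽₂)` for `k ≥ 0`: the image of `C^{k-1}(X, 𝔽₂)`. -/
def coboundaries (X : WeightedComplex V) (k : ℕ) : Submodule (ZMod 2) (X.Cochain (k + 1)) :=
  LinearMap.range (X.d k)

/-- `‖φ‖`: the total weight of the support of the cochain `φ`. -/
noncomputable def cnorm (X : WeightedComplex V) {r : ℕ} (φ : X.Cochain r) : ℝ :=
  ∑ σ : {σ // σ ∈ X.cells r}, if φ σ = 1 then X.weight σ.1 else 0

/-- `min {‖φ - ψ‖ : ψ ∈ B^k(X, 𝔽₂)}` for `φ ∈ C^k(X, 𝔽₂)`, a minimum over a finite nonempty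
set. -/
noncomputable def distToCoboundaries (X : WeightedComplex V) (k : ℕ) (φ : X.Cochain (k + 1)) : ℝ :=
  sInf {x : ℝ | ∃ ψ ∈ X.coboundaries k, x = X.cnorm (φ - ψ)}

/-- The `k`-th coboundary expansion `ε_k(X)`: the minimum, over the cochains `φ ∈ C^k(X, 𝔽₂)` that
are not coboundaries, of `‖dφ‖ / min {‖φ - ψ‖ : ψ ∈ B^k(X, 𝔽₂)}`. The set is finite, and it is
nonempty whenever `k` is less than the dimension of `X`. -/
noncomputable def coboundaryExpansion (X : WeightedComplex V) (k : ℕ) : ℝ :=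
  sInf {x : ℝ | ∃ φ : X.Cochain (k + 1), φ ∉ X.coboundaries k ∧
    x = X.cnorm (X.d (k + 1) φ) / X.distToCoboundaries k φ}

/-- The localization `φ_τ(σ) = φ(τ ∪ σ)` of a cochain at a simplex `τ` with `t` vertices, a
cochain of the link of `τ`. -/
def localize (X : WeightedComplex V) {t s r : ℕ} (h : t + s = r) (φ : X.Cochain r)
    (τ : Finset V) (hτ : τ ∈ X.cells t) : (X.link τ (mem_cells.mp hτ).1).Cochain s :=
  fun σ => φ ⟨τ ∪ σ.1, by
    have h1 := mem_cells.mp σ.2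
    have h2 := (Finset.mem_filter.mp h1.1).2
    refine mem_cells.mpr ⟨h2.2, ?_⟩
    have h3 := (mem_cells.mp hτ).2
    have h4 := Finset.card_union_of_disjoint h2.1
    have h5 := h1.2
    omega⟩

/-- `ε`-local minimality of a cochain `φ ∈ C^k(X, 𝔽₂)`. For `k = 0` it says that
`‖φ‖ ≤ (1 + ε) m(X^{(0)}) / 2`. For `k ≥ 1` it says that for all `0 ≤ j ≤ k - 1`, all simplices `τ`
of dimension `j` and all `ψ ∈ B^{k-j-1}(X_τ, 𝔽₂)` one has `‖φ_τ‖ ≤ ‖φ_τ - ψ‖ + ε m(τ)`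
(below `i = k - j - 1`). -/
def IsLocallyMinimal (X : WeightedComplex V) (ε : ℝ) : (k : ℕ) → X.Cochain (k + 1) → Prop
  | 0, φ => X.cnorm φ ≤ (1 + ε) * X.totalWeight 1 / 2
  | k + 1, φ => ∀ (j i : ℕ) (h : (j + 1) + (i + 1) = k + 1 + 1)
      (τ : Finset V) (hτ : τ ∈ X.cells (j + 1)),
      ∀ ψ ∈ (X.link τ (mem_cells.mp hτ).1).coboundaries i,
        (X.link τ (mem_cells.mp hτ).1).cnorm (X.localize h φ τ hτ) ≤
          (X.link τ (mem_cells.mp hτ).1).cnorm (X.localize h φ τ hτ - ψ) + ε * X.weight τ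

/-! ### Spectral gaps -/

/-- The 1-skeleton as a graph on the set `X^{(0)}` of vertices `{v}`: two vertices are adjacent
when their union is an edge. -/
def oneSkeleton (X : WeightedComplex V) : SimpleGraph {v // v ∈ X.cells 1} where
  Adj u v := u.1 ∪ v.1 ∈ X.cells 2
  symm := ⟨fun u v h => by rwa [Finset.union_comm]⟩
  loopless := ⟨fun u h => by
    rw [Finset.union_self] at h
    have h1 := (mem_cells.mp h).2
    have h2 := (mem_cells.mp u.2).2
    omega⟩

/-- The weighted graph Laplacian of the 1-skeleton,
`Δφ(v) = φ(v) - (1 / m(v)) ∑_{u : {u,v} an edge} m({u,v}) φ(u)`. -/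
noncomputable def laplacian (X : WeightedComplex V) :
    ({v // v ∈ X.cells 1} → ℝ) →ₗ[ℝ] ({v // v ∈ X.cells 1} → ℝ) where
  toFun φ := fun v => φ v - 1 / X.weight v.1 *
    ∑ u : {v // v ∈ X.cells 1}, if u.1 ∪ v.1 ∈ X.cells 2 then X.weight (u.1 ∪ v.1) * φ u else 0
  map_add' φ ψ := by
    ext v
    have : (∑ u : {v // v ∈ X.cells 1}, if u.1 ∪ v.1 ∈ X.cells 2 then
          X.weight (u.1 ∪ v.1) * (φ u + ψ u) else 0) =
        (∑ u : {v // v ∈ X.cells 1}, if u.1 ∪ v.1 ∈ X.cells 2 then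
          X.weight (u.1 ∪ v.1) * φ u else 0) +
        ∑ u : {v // v ∈ X.cells 1}, if u.1 ∪ v.1 ∈ X.cells 2 then
          X.weight (u.1 ∪ v.1) * ψ u else 0 := by
      rw [← Finset.sum_add_distrib]
      refine Finset.sum_congr rfl fun u _ => ?_
      split_ifs <;> ring
    simp only [Pi.add_apply, this]
    ring
  map_smul' a φ := by
    ext v
    have : (∑ u : {v // v ∈ X.cells 1}, if u.1 ∪ v.1 ∈ X.cells 2 then
          X.weight (u.1 ∪ v.1) * (a * φ u) else 0) =
        a * ∑ u : {v // v ∈ X.cells 1}, if u.1 ∪ v.1 ∈ X.cells 2 then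
          X.weight (u.1 ∪ v.1) * φ u else 0 := by
      rw [Finset.mul_sum]
      refine Finset.sum_congr rfl fun u _ => ?_
      split_ifs <;> ring
    simp only [Pi.smul_apply, smul_eq_mul, RingHom.id_apply, this]
    ring

/-- `λ(X)`: the smallest positive eigenvalue of the Laplacian of the 1-skeleton. -/
noncomputable def spectralGap (X : WeightedComplex V) : ℝ :=
  sInf {μ : ℝ | 0 < μ ∧ Module.End.HasEigenvalue X.laplacian μ}

/-- `lam`-local spectral expansion of a complex of dimension `n`, for `(n - 1) / n < lam ≤ 1`: all
links of dimension `> 0`, including the link `X` of the empty simplex, are connected, and all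
one-dimensional links (those of the simplices of dimension `n - 2`) have spectral gap at least
`lam`. -/
def HasLocalSpectralExpansion (X : WeightedComplex V) (n : ℕ) (lam : ℝ) : Prop :=
  X.rank = n + 1 ∧ ((n : ℝ) - 1) / n < lam ∧ lam ≤ 1 ∧
  (∀ (τ : Finset V) (hτ : τ ∈ X.faces), 2 ≤ (X.link τ hτ).rank →
    (X.link τ hτ).oneSkeleton.Connected) ∧
  (∀ (τ : Finset V) (hτ : τ ∈ X.faces), (X.link τ hτ).rank = 2 →
    lam ≤ (X.link τ hτ).spectralGap)

end WeightedComplex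

/-!
The proof is an isoperimetric argument for the support `S` of a locally minimal cochain `φ`.

*Spectral part.* If the walks on the links of the vertices are bounded by `κ` on the functions
orthogonal to the constants, then a nontrivial eigenvalue `x` of the walk on the complex satisfies
`x ≤ κ + (1 - κ) x²`, hence `x ≤ κ / (1 - κ)` (`eigen_le_of_link_bounds`). Starting from the
one-dimensional links, all links of positive dimension are therefore as good expanders as desired
when `lam` is close to `1` (`HasLocalSpectralExpansion.hasWalkBound_link`). The resulting mixing
inequality in the link of `τ` bounds the weight of the pairs of adjacent elements of `S` that meet
in `τ` by `deg(τ) (κ + deg(τ) / m(τ))`, where `deg(τ)` is the weight of the elements of `S`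
containing `τ` (`pairMass_singleton_le`). So the pairs that meet in a *thin* face, one with
`deg(τ) ≤ δ m(τ)`, are negligible, while at the *fat* faces local minimality gives
`deg(τ) ≤ (1 + ε') m(τ) / 2`.

*Spectral bound.* A simplex with `k` facets in `S` has `k (k - 1)` ordered pairs of them, and
`k - k (k - 1)` is at most `1` for odd `k` and at most `0` for even `k`. Thus `‖dφ‖` is at least
`‖φ‖` minus the weight of the adjacent pairs, which up to small errors is half of the sum over `S`
of the number of fat facets (`le_oddMass`). For `1`-cochains there are so few fat vertices that
almost no edge has two of them, which leaves about `‖φ‖ / 2`.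

*Expansion bound.* For `2`-cochains let `a` be the weight of the triangles of `S` with at least two
fat edges. The spectral bound is about `(‖φ‖ - a) / 2`. Two fat edges of a triangle meet, up to
small errors, in a vertex that is fat for the set of fat edges, and there are so few fat vertices
that a simplex contains at most one of them, again up to small errors. Applying the coboundary
expansion of the link to `φ_v` for the fat vertices `v` gives `‖dφ‖ ≥ ε (a + p) - p` up to small
errors, where `p` is the weight of the triangles of `S` with a fat vertex and at most one fat edge
(`card_odd_vertices_le`, `sum_odd_vertices_le`). As `p ≤ ‖φ‖ - a` and `ε ≤ 1`, twice the first
bound plus the second gives `3 ‖dφ‖ ≥ ε ‖φ‖` up to small errors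
(`three_tenths_le_of_bounds`).
-/

open Finset

namespace WeightedComplex

variable {V : Type*} [DecidableEq V]

/-! ### Simplices of links -/

theorem mem_link_cells {X : WeightedComplex V} {τ : Finset V} {hτ : τ ∈ X.faces} {s : ℕ}
    {σ : Finset V} :
    σ ∈ (X.link τ hτ).cells s ↔ Disjoint τ σ ∧ τ ∪ σ ∈ X.faces ∧ σ.card = s := by
  rw [mem_cells]
  constructor
  · rintro ⟨h, hs⟩
    have h := (Finset.mem_filter.mp h).2
    exact ⟨h.1, h.2, hs⟩
  · rintro ⟨h1, h2, h3⟩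
    exact ⟨Finset.mem_filter.mpr ⟨X.down_closed _ h2 _ subset_union_right, h1, h2⟩, h3⟩

/-- Joining with `τ` identifies the simplices of the link of `τ` with the simplices of `X`
containing `τ`. -/
theorem sum_link_cells {M : Type*} [AddCommMonoid M] (X : WeightedComplex V) {τ : Finset V} {t : ℕ}
    (hτ : τ ∈ X.cells t) (s : ℕ) (g : Finset V → M) :
    ∑ σ ∈ (X.link τ (mem_cells.mp hτ).1).cells s, g (τ ∪ σ) =
      ∑ η ∈ X.cells (t + s) with τ ⊆ η, g η := by
  refine Finset.sum_bij' (fun σ _ => τ ∪ σ) (fun η _ => η \ τ) ?_ ?_ ?_ ?_ ?_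
  · intro σ hσ
    rw [mem_link_cells] at hσ
    rw [Finset.mem_filter, mem_cells, Finset.card_union_of_disjoint hσ.1, hσ.2.2,
      (mem_cells.mp hτ).2]
    exact ⟨⟨hσ.2.1, rfl⟩, subset_union_left⟩
  · intro η hη
    rw [Finset.mem_filter, mem_cells] at hη
    rw [mem_link_cells, Finset.union_sdiff_of_subset hη.2, Finset.card_sdiff_of_subset hη.2,
      hη.1.2, (mem_cells.mp hτ).2]
    exact ⟨Finset.disjoint_sdiff, hη.1.1, by omega⟩
  · intro σ hσ
    rw [mem_link_cells] at hσ
    exact Finset.union_sdiff_cancel_left hσ.1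
  · intro η hη
    exact Finset.union_sdiff_of_subset (Finset.mem_filter.mp hη).2
  · intro σ _
    rfl

theorem sum_cofaces (X : WeightedComplex V) {σ : Finset V} {r : ℕ} (hσ : σ ∈ X.cells r)
    (hr : r < X.rank) : ∑ η ∈ X.cells (r + 1) with σ ⊆ η, X.weight η = X.weight σ := by
  obtain ⟨h1, rfl⟩ := mem_cells.mp hσ
  rw [X.weight_sum σ h1 hr]
  refine Finset.sum_congr ?_ fun _ _ => rfl
  ext η
  simp only [Finset.mem_filter, cells]
  tauto

theorem weight_pos_of_mem_cells {X : WeightedComplex V} {σ : Finset V} {r : ℕ}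
    (hσ : σ ∈ X.cells r) : 0 < X.weight σ := X.weight_pos _ (mem_cells.mp hσ).1

theorem empty_mem_cells (X : WeightedComplex V) : ∅ ∈ X.cells 0 :=
  mem_cells.mpr ⟨X.empty_mem, rfl⟩

theorem mem_cells_of_subset {X : WeightedComplex V} {σ τ : Finset V} {r : ℕ} (hσ : σ ∈ X.cells r)
    (h : τ ⊆ σ) : τ ∈ X.cells τ.card :=
  mem_cells.mpr ⟨X.down_closed _ (mem_cells.mp hσ).1 _ h, rfl⟩

/-- The weight of `σ` is the total weight of the simplices obtained by adding one vertex. -/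
theorem sum_union_vertex (X : WeightedComplex V) {σ : Finset V} {r : ℕ} (hσ : σ ∈ X.cells r)
    (hr : r < X.rank) :
    (∑ v ∈ X.cells 1, if v ∪ σ ∈ X.cells (r + 1) then X.weight (v ∪ σ) else 0) = X.weight σ := by
  rw [← X.sum_cofaces hσ hr, ← X.sum_link_cells hσ 1, ← Finset.sum_filter]
  refine Finset.sum_congr ?_ fun v _ => by rw [Finset.union_comm]
  ext v
  rw [Finset.mem_filter, mem_link_cells, Finset.union_comm v σ]
  obtain ⟨-, hc⟩ := mem_cells.mp hσ
  constructor
  · rintro ⟨hv, h⟩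
    rw [mem_cells] at hv h
    refine ⟨?_, h.1, hv.2⟩
    rw [← Finset.card_union_eq_card_add_card]
    omega
  · rintro ⟨hd, h, h1⟩
    refine ⟨mem_cells.mpr ⟨X.down_closed _ h _ subset_union_right, h1⟩, mem_cells.mpr ⟨h, ?_⟩⟩
    rw [Finset.card_union_of_disjoint hd]
    omega

theorem sum_weight_vertices (X : WeightedComplex V) (hr : 0 < X.rank) :
    ∑ v ∈ X.cells 1, X.weight v = X.weight ∅ := by
  rw [← X.sum_cofaces X.empty_mem_cells hr]
  simp

/-- The link of `σ` in the link of `τ` is the link of `τ ∪ σ`. -/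
theorem link_link (X : WeightedComplex V) {τ σ : Finset V} (hτ : τ ∈ X.faces)
    (hσ : σ ∈ (X.link τ hτ).faces) (hu : τ ∪ σ ∈ X.faces) :
    (X.link τ hτ).link σ hσ = X.link (τ ∪ σ) hu := by
  have hd : Disjoint τ σ := (Finset.mem_filter.mp hσ).2.1
  unfold link
  simp only [WeightedComplex.mk.injEq]
  refine ⟨?_, ?_, ?_⟩
  · ext ρ
    simp only [Finset.mem_filter, Finset.disjoint_union_left, Finset.disjoint_union_right,
      Finset.union_assoc]
    constructor
    · tauto
    · rintro ⟨h1, ⟨h2, h3⟩, h4⟩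
      exact ⟨⟨h1, h2, X.down_closed _ h4 _ (union_subset_union_right subset_union_right)⟩, h3,
        X.down_closed _ h4 _ subset_union_right, ⟨hd, h2⟩, h4⟩
  · rw [Finset.card_union_of_disjoint hd]
    omega
  · funext ρ
    rw [Finset.union_assoc]

theorem link_empty (X : WeightedComplex V) (h : ∅ ∈ X.faces) : X.link ∅ h = X := by
  obtain ⟨faces, rank, weight, _, _, _, _, _⟩ := X
  unfold link
  simp

/-! ### Spectral gaps of links -/

/-- The quadratic form of the weighted adjacency operator of the 1-skeleton. -/
noncomputable def adjForm (X : WeightedComplex V) (f : Finset V → ℝ) : ℝ :=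
  ∑ u ∈ X.cells 1, ∑ w ∈ X.cells 1,
    if u ∪ w ∈ X.cells 2 then X.weight (u ∪ w) * (f u * f w) else 0

/-- The random walk on the 1-skeleton is bounded by `κ` from above on the functions orthogonal to
the constants, stated as an inequality of quadratic forms. -/
def HasWalkBound (X : WeightedComplex V) (κ : ℝ) : Prop :=
  ∀ f : Finset V → ℝ, X.adjForm f ≤ κ * ∑ u ∈ X.cells 1, X.weight u * f u ^ 2 +
    (1 - κ) * (∑ u ∈ X.cells 1, X.weight u * f u) ^ 2 / X.weight ∅

/-- Summation over the neighbours of a vertex gives back its weight. -/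
theorem sum_neighbours (X : WeightedComplex V) (hr : 2 ≤ X.rank) {u : Finset V}
    (hu : u ∈ X.cells 1) :
    (∑ w ∈ X.cells 1, if u ∪ w ∈ X.cells 2 then X.weight (u ∪ w) else 0) = X.weight u := by
  rw [← X.sum_union_vertex hu (by omega)]
  simp only [Finset.union_comm]

theorem sum_sq_sub_adjForm (X : WeightedComplex V) (hr : 2 ≤ X.rank) (f : Finset V → ℝ) :
    (∑ u ∈ X.cells 1, ∑ w ∈ X.cells 1,
      if u ∪ w ∈ X.cells 2 then X.weight (u ∪ w) * (f u - f w) ^ 2 else 0) =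
      2 * (∑ u ∈ X.cells 1, X.weight u * f u ^ 2 - X.adjForm f) := by
  have h1 : (∑ u ∈ X.cells 1, ∑ w ∈ X.cells 1,
      if u ∪ w ∈ X.cells 2 then X.weight (u ∪ w) * f u ^ 2 else 0) =
      ∑ u ∈ X.cells 1, X.weight u * f u ^ 2 := by
    refine Finset.sum_congr rfl fun u hu => ?_
    rw [← X.sum_neighbours hr hu, Finset.sum_mul]
    refine Finset.sum_congr rfl fun w _ => ?_
    split_ifs <;> simp
  have h2 : (∑ u ∈ X.cells 1, ∑ w ∈ X.cells 1,
      if u ∪ w ∈ X.cells 2 then X.weight (u ∪ w) * f w ^ 2 else 0) =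
      ∑ u ∈ X.cells 1, X.weight u * f u ^ 2 := by
    rw [Finset.sum_comm, ← h1]
    simp only [Finset.union_comm]
  rw [mul_sub, two_mul]
  nth_rewrite 1 [← h1]
  rw [← h2, adjForm, Finset.mul_sum, ← Finset.sum_add_distrib, ← Finset.sum_sub_distrib]
  refine Finset.sum_congr rfl fun u _ => ?_
  rw [Finset.mul_sum, ← Finset.sum_add_distrib, ← Finset.sum_sub_distrib]
  refine Finset.sum_congr rfl fun w _ => ?_
  split_ifs <;> ring

/-- `x` is an eigenvalue of the random walk with eigenfunction `f`. -/
def IsWalkEigen (X : WeightedComplex V) (x : ℝ) (f : Finset V → ℝ) : Prop :=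
  ∀ v ∈ X.cells 1,
    (∑ u ∈ X.cells 1, if v ∪ u ∈ X.cells 2 then X.weight (v ∪ u) * f u else 0) =
      x * (X.weight v * f v)

theorem IsWalkEigen.adjForm_eq {X : WeightedComplex V} {x : ℝ} {f : Finset V → ℝ}
    (h : X.IsWalkEigen x f) : X.adjForm f = x * ∑ u ∈ X.cells 1, X.weight u * f u ^ 2 := by
  rw [adjForm, Finset.mul_sum]
  refine Finset.sum_congr rfl fun u hu => ?_
  have := h u hu
  calc _ = f u * ∑ w ∈ X.cells 1, (if u ∪ w ∈ X.cells 2 then X.weight (u ∪ w) * f w else 0) := by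
        rw [Finset.mul_sum]
        refine Finset.sum_congr rfl fun w _ => ?_
        split_ifs <;> ring
    _ = _ := by rw [this]; ring

theorem IsWalkEigen.hasEigenvalue {X : WeightedComplex V} {x : ℝ} {f : Finset V → ℝ}
    (h : X.IsWalkEigen x f) {v : Finset V} (hv : v ∈ X.cells 1) (hf : f v ≠ 0) :
    Module.End.HasEigenvalue X.laplacian (1 - x) := by
  refine Module.End.hasEigenvalue_of_hasEigenvector (x := fun u => f u.1) ?_
  rw [Module.End.hasEigenvector_iff, Module.End.mem_eigenspace_iff]
  refine ⟨?_, fun h0 => hf (congrFun h0 ⟨v, hv⟩)⟩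
  funext u
  have hu := h u.1 u.2
  have hw := (weight_pos_of_mem_cells u.2).ne'
  simp only [laplacian, LinearMap.coe_mk, AddHom.coe_mk, Pi.smul_apply, smul_eq_mul]
  rw [Finset.sum_coe_sort (X.cells 1) (fun w => if w ∪ u.1 ∈ X.cells 2 then
    X.weight (w ∪ u.1) * f w else 0)]
  simp only [Finset.union_comm _ u.1]
  rw [hu]
  field_simp

theorem IsWalkEigen.le_one {X : WeightedComplex V} (hr : 2 ≤ X.rank) {x : ℝ} {f : Finset V → ℝ}
    (h : X.IsWalkEigen x f) {v : Finset V} (hv : v ∈ X.cells 1) (hf : f v ≠ 0) : x ≤ 1 := by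
  have h1 := X.sum_sq_sub_adjForm hr f
  rw [h.adjForm_eq] at h1
  have h2 : 0 ≤ ∑ u ∈ X.cells 1, ∑ w ∈ X.cells 1,
      if u ∪ w ∈ X.cells 2 then X.weight (u ∪ w) * (f u - f w) ^ 2 else 0 := by
    refine Finset.sum_nonneg fun u _ => Finset.sum_nonneg fun w _ => ?_
    split_ifs with hc
    · have := weight_pos_of_mem_cells hc
      positivity
    · rfl
  have h3 : 0 < ∑ u ∈ X.cells 1, X.weight u * f u ^ 2 := by
    refine Finset.sum_pos' (fun u hu => ?_) ⟨v, hv, ?_⟩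
    · have := weight_pos_of_mem_cells hu
      positivity
    · have := weight_pos_of_mem_cells hv
      positivity
  nlinarith

/-- On a connected 1-skeleton the eigenfunctions of the walk with eigenvalue `1` are constant. -/
theorem IsWalkEigen.const_of_eq_one {X : WeightedComplex V} (hr : 2 ≤ X.rank)
    (hc : X.oneSkeleton.Connected) {f : Finset V → ℝ} (h : X.IsWalkEigen 1 f) {u v : Finset V}
    (hu : u ∈ X.cells 1) (hv : v ∈ X.cells 1) : f u = f v := by
  have h1 := X.sum_sq_sub_adjForm hr f
  rw [h.adjForm_eq, one_mul, sub_self, mul_zero] at h1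
  have hnn : ∀ u ∈ X.cells 1, ∀ w ∈ X.cells 1, 0 ≤
      if u ∪ w ∈ X.cells 2 then X.weight (u ∪ w) * (f u - f w) ^ 2 else 0 := by
    intro u _ w _
    split_ifs with hc
    · have := weight_pos_of_mem_cells hc
      positivity
    · rfl
  rw [Finset.sum_eq_zero_iff_of_nonneg fun u hu => Finset.sum_nonneg (hnn u hu)] at h1
  have hadj : ∀ a b : {v // v ∈ X.cells 1}, X.oneSkeleton.Adj a b → f a.1 = f b.1 := by
    intro a b hab
    have h2 := h1 a.1 a.2
    rw [Finset.sum_eq_zero_iff_of_nonneg (hnn a.1 a.2)] at h2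
    have h3 := h2 b.1 b.2
    have hab' : a.1 ∪ b.1 ∈ X.cells 2 := hab
    rw [if_pos hab', mul_eq_zero] at h3
    rcases h3 with h3 | h3
    · exact absurd h3 (weight_pos_of_mem_cells hab').ne'
    · exact sub_eq_zero.mp (pow_eq_zero_iff (two_ne_zero) |>.mp h3)
  obtain ⟨p⟩ := hc.preconnected ⟨u, hu⟩ ⟨v, hv⟩
  have : ∀ (a b : {v // v ∈ X.cells 1}), X.oneSkeleton.Walk a b → f a.1 = f b.1 := by
    intro a b p
    induction p with
    | nil => rfl
    | cons h _ ih => exact (hadj _ _ h).trans ih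
  exact this _ _ p

/-- The adjacency matrix of the 1-skeleton, normalized so as to be symmetric. -/
noncomputable def normAdj (X : WeightedComplex V) :
    Matrix {v // v ∈ X.cells 1} {v // v ∈ X.cells 1} ℝ := fun u w =>
  if u.1 ∪ w.1 ∈ X.cells 2 then X.weight (u.1 ∪ w.1) / (√(X.weight u.1) * √(X.weight w.1)) else 0

theorem normAdj_isHermitian (X : WeightedComplex V) : X.normAdj.IsHermitian := by
  ext u w
  simp only [Matrix.conjTranspose_apply, normAdj, star_trivial, Finset.union_comm w.1,
    mul_comm √(X.weight w.1)]

/-- The extension by zero of `v ↦ b v / √m(v)`. -/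
noncomputable def unnormalize (X : WeightedComplex V)
    (b : EuclideanSpace ℝ {v // v ∈ X.cells 1}) : Finset V → ℝ :=
  fun v => if h : v ∈ X.cells 1 then b ⟨v, h⟩ / √(X.weight v) else 0

theorem sqrt_weight_pos {X : WeightedComplex V} {σ : Finset V} {r : ℕ}
    (hσ : σ ∈ X.cells r) : 0 < √(X.weight σ) := Real.sqrt_pos.mpr (weight_pos_of_mem_cells hσ)

theorem unnormalize_apply (X : WeightedComplex V)
    (b : EuclideanSpace ℝ {v // v ∈ X.cells 1}) (v : {v // v ∈ X.cells 1}) :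
    X.unnormalize b v.1 = b v / √(X.weight v.1) := by
  simp [unnormalize, v.2]

theorem isWalkEigen_unnormalize (X : WeightedComplex V) {x : ℝ}
    {b : EuclideanSpace ℝ {v // v ∈ X.cells 1}} (h : Matrix.mulVec X.normAdj b.ofLp = x • b.ofLp) :
    X.IsWalkEigen x (X.unnormalize b) := by
  intro v hv
  have h1 := congrFun h ⟨v, hv⟩
  simp only [Matrix.mulVec, dotProduct, normAdj, Pi.smul_apply, smul_eq_mul] at h1
  rw [← Finset.sum_coe_sort (X.cells 1), X.unnormalize_apply b ⟨v, hv⟩]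
  have hs := sqrt_weight_pos hv
  have hm := Real.mul_self_sqrt (weight_pos_of_mem_cells hv).le
  calc _ = √(X.weight v) * (x * b ⟨v, hv⟩) := by
        rw [← h1, Finset.mul_sum]
        refine Finset.sum_congr rfl fun u _ => ?_
        have hu := sqrt_weight_pos u.2
        rw [unnormalize_apply]
        split_ifs
        · field_simp
        · simp
    _ = x * (√(X.weight v) * √(X.weight v) * (b ⟨v, hv⟩ / √(X.weight v))) := by field_simp
    _ = _ := by rw [hm]

theorem adjForm_le_of_orthogonal (X : WeightedComplex V) (hr : 2 ≤ X.rank)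
    (hc : X.oneSkeleton.Connected) {κ : ℝ}
    (h : ∀ x f v, X.IsWalkEigen x f → v ∈ X.cells 1 → f v ≠ 0 → x < 1 → x ≤ κ)
    (g : Finset V → ℝ) (hg : ∑ v ∈ X.cells 1, X.weight v * g v = 0) :
    X.adjForm g ≤ κ * ∑ v ∈ X.cells 1, X.weight v * g v ^ 2 := by
  classical
  set hA := X.normAdj_isHermitian with hAdef
  set b := hA.eigenvectorBasis
  set G : EuclideanSpace ℝ {v // v ∈ X.cells 1} :=
    WithLp.toLp 2 fun v => √(X.weight v.1) * g v.1 with hG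
  have hT := Matrix.isSymmetric_toEuclideanLin_iff.mpr hA
  have hbi : ∀ i, Matrix.toEuclideanLin X.normAdj (b i) = hA.eigenvalues i • b i := by
    intro i
    have := hA.mulVec_eigenvectorBasis i
    ext v
    exact congrFun this v
  have hnorm : ∑ i, inner ℝ (b i) G ^ 2 = ∑ v ∈ X.cells 1, X.weight v * g v ^ 2 := by
    have h1 := b.sum_inner_mul_inner G G
    simp only [real_inner_comm (b _) G, ← pow_two] at h1
    rw [h1, EuclideanSpace.inner_eq_star_dotProduct, ← Finset.sum_coe_sort (X.cells 1)]
    refine Finset.sum_congr rfl fun v _ => ?_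
    have := Real.mul_self_sqrt (weight_pos_of_mem_cells v.2).le
    simp only [hG, Pi.star_apply, star_trivial]
    linear_combination g v.1 ^ 2 * this
  have hform : ∑ i, hA.eigenvalues i * inner ℝ (b i) G ^ 2 = X.adjForm g := by
    have h1 := b.sum_inner_mul_inner G (Matrix.toEuclideanLin X.normAdj G)
    have h2 : ∀ i, inner ℝ G (b i) * inner ℝ (b i) (Matrix.toEuclideanLin X.normAdj G) =
        hA.eigenvalues i * inner ℝ (b i) G ^ 2 := by
      intro i
      rw [← hT (b i) G, hbi, real_inner_smul_left, real_inner_comm]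
      ring
    rw [Finset.sum_congr rfl fun i _ => h2 i] at h1
    rw [h1, EuclideanSpace.inner_eq_star_dotProduct, adjForm, ← Finset.sum_coe_sort (X.cells 1)]
    refine Finset.sum_congr rfl fun v _ => ?_
    rw [← Finset.sum_coe_sort (X.cells 1)]
    simp only [hG, Pi.star_apply, star_trivial, Matrix.toLpLin_apply, Matrix.mulVec,
      dotProduct, normAdj, Finset.sum_mul]
    refine Finset.sum_congr rfl fun u _ => ?_
    have hu := sqrt_weight_pos u.2
    have hv := sqrt_weight_pos v.2
    split_ifs
    · field_simp
    · simp
  rw [← hform, ← hnorm, Finset.mul_sum]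
  refine Finset.sum_le_sum fun i _ => ?_
  have hwe := X.isWalkEigen_unnormalize (hA.mulVec_eigenvectorBasis i)
  obtain ⟨v, hv⟩ : ∃ v, b i v ≠ 0 := by
    by_contra! h0
    have : b i = 0 := by
      ext v
      simpa using h0 v
    exact b.orthonormal.ne_zero i this
  have hfv : X.unnormalize (b i) v.1 ≠ 0 := by
    rw [unnormalize_apply]
    exact div_ne_zero hv (sqrt_weight_pos v.2).ne'
  rcases (hwe.le_one hr v.2 hfv).lt_or_eq with hlt | heq
  · exact mul_le_mul_of_nonneg_right (h _ _ _ hwe v.2 hfv hlt) (sq_nonneg _)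
  -- an eigenvector for the eigenvalue `1` is constant after rescaling, hence orthogonal to `G`
  · have h0 : inner ℝ (b i) G = 0 := by
      rw [heq] at hwe
      rw [EuclideanSpace.inner_eq_star_dotProduct]
      calc _ = ∑ u : {v // v ∈ X.cells 1},
            X.unnormalize (b i) v.1 * (X.weight u.1 * g u.1) := by
            refine Finset.sum_congr rfl fun u _ => ?_
            have hu := sqrt_weight_pos u.2
            rw [← hwe.const_of_eq_one hr hc u.2 v.2, unnormalize_apply]
            have := Real.mul_self_sqrt (weight_pos_of_mem_cells u.2).le
            simp only [hG, Pi.star_apply, star_trivial]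
            change _ = b i u / _ * _
            rw [div_mul_eq_mul_div, eq_div_iff hu.ne']
            linear_combination (g u.1 * b i u) * this
        _ = 0 := by
            rw [← Finset.mul_sum, Finset.sum_coe_sort (X.cells 1) fun u => X.weight u * g u, hg,
              mul_zero]
    rw [h0]
    simp

/-- A bound on the nontrivial eigenvalues of the walk gives the bound on the quadratic form. -/
theorem hasWalkBound_of_eigen (X : WeightedComplex V) (hr : 2 ≤ X.rank)
    (hc : X.oneSkeleton.Connected) {κ : ℝ}
    (h : ∀ x f v, X.IsWalkEigen x f → v ∈ X.cells 1 → f v ≠ 0 → x < 1 → x ≤ κ) :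
    X.HasWalkBound κ := by
  intro f
  set M := X.weight ∅ with hM
  have hMpos : 0 < M := weight_pos_of_mem_cells X.empty_mem_cells
  set c := (∑ u ∈ X.cells 1, X.weight u * f u) / M with hcdef
  have hcM : ∑ u ∈ X.cells 1, X.weight u * f u = c * M := by
    rw [hcdef]
    field_simp
  have hsum := X.sum_weight_vertices (by omega)
  have hmean : ∑ u ∈ X.cells 1, X.weight u * (f u - c) = 0 := by
    simp only [mul_sub, Finset.sum_sub_distrib, ← Finset.sum_mul]
    rw [hsum, hcM]
    ring
  have h1 := X.adjForm_le_of_orthogonal hr hc h (fun u => f u - c) hmean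
  have h2 : ∑ v ∈ X.cells 1, X.weight v * (f v - c) ^ 2 =
      ∑ v ∈ X.cells 1, X.weight v * f v ^ 2 - c ^ 2 * M := by
    have : ∀ v, X.weight v * (f v - c) ^ 2 =
      X.weight v * f v ^ 2 - 2 * c * (X.weight v * f v) + c ^ 2 * X.weight v := fun v => by ring
    simp only [this, Finset.sum_add_distrib, Finset.sum_sub_distrib, ← Finset.mul_sum]
    rw [hsum, hcM]
    ring
  have h3 := X.sum_sq_sub_adjForm hr f
  have h4 := X.sum_sq_sub_adjForm hr fun u => f u - c
  simp only [sub_sub_sub_cancel_right] at h4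
  rw [h3] at h4
  rw [h2] at h1 h4
  rw [hcM]
  have h5 : (1 - κ) * (c * M) ^ 2 / M = (1 - κ) * c ^ 2 * M := by field_simp
  rw [h5]
  linarith

theorem union_mem_cells_two_iff {X : WeightedComplex V} {v u : Finset V} (hv : v ∈ X.cells 1)
    (hu : u ∈ X.cells 1) :
    u ∈ (X.link v (mem_cells.mp hv).1).cells 1 ↔ v ∪ u ∈ X.cells 2 := by
  obtain ⟨-, hu⟩ := mem_cells.mp hu
  have hv := (mem_cells.mp hv).2
  rw [mem_link_cells, mem_cells, ← Finset.card_union_eq_card_add_card]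
  constructor
  · rintro ⟨h1, h2, h3⟩
    exact ⟨h2, by omega⟩
  · rintro ⟨h1, h2⟩
    exact ⟨by omega, h1, hu⟩

theorem link_cells_one (X : WeightedComplex V) {v : Finset V} (hv : v ∈ X.cells 1) :
    (X.link v (mem_cells.mp hv).1).cells 1 = {u ∈ X.cells 1 | v ∪ u ∈ X.cells 2} := by
  ext u
  rw [Finset.mem_filter]
  constructor
  · intro hu
    have h1 := mem_link_cells.mp hu
    have hu' : u ∈ X.cells 1 :=
      mem_cells.mpr ⟨X.down_closed _ h1.2.1 _ subset_union_right, h1.2.2⟩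
    exact ⟨hu', (union_mem_cells_two_iff hv hu').mp hu⟩
  · rintro ⟨h1, h2⟩
    exact (union_mem_cells_two_iff hv h1).mpr h2

theorem adjForm_link (X : WeightedComplex V) {v : Finset V} (hv : v ∈ X.cells 1)
    (f : Finset V → ℝ) :
    (X.link v (mem_cells.mp hv).1).adjForm f = ∑ u ∈ X.cells 1, ∑ w ∈ X.cells 1,
      if v ∪ (u ∪ w) ∈ X.cells 3 then X.weight (v ∪ (u ∪ w)) * (f u * f w) else 0 := by
  have key : ∀ u ∈ X.cells 1, ∀ w ∈ X.cells 1,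
      (v ∪ (u ∪ w) ∈ X.cells 3 ↔ (v ∪ u ∈ X.cells 2 ∧ v ∪ w ∈ X.cells 2) ∧
        u ∪ w ∈ (X.link v (mem_cells.mp hv).1).cells 2) := by
    intro u hu w hw
    have hv1 := (mem_cells.mp hv).2
    have hu1 := (mem_cells.mp hu).2
    have hw1 := (mem_cells.mp hw).2
    rw [mem_link_cells, mem_cells, mem_cells, mem_cells]
    have e1 := Finset.card_union_le v (u ∪ w)
    have e2 := Finset.card_union_le u w
    have e3 := Finset.card_union_le (v ∪ u) w
    have e4 := Finset.card_union_le (v ∪ w) u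
    have e5 := Finset.card_union_le v u
    have e6 := Finset.card_union_le v w
    constructor
    · rintro ⟨h1, h2⟩
      refine ⟨⟨⟨X.down_closed _ h1 _ (union_subset_union_right subset_union_left), ?_⟩,
        X.down_closed _ h1 _ (union_subset_union_right subset_union_right), ?_⟩, ?_, h1, ?_⟩
      · rw [Finset.union_assoc] at e3
        omega
      · rw [Finset.union_assoc, Finset.union_comm w u] at e4
        omega
      · rw [← Finset.card_union_eq_card_add_card]
        omega
      · omega
    · rintro ⟨-, h1, h2, h3⟩
      rw [Finset.card_union_of_disjoint h1]
      exact ⟨h2, by omega⟩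
  rw [adjForm, link_cells_one X hv, Finset.sum_filter]
  refine Finset.sum_congr rfl fun u hu => ?_
  rw [Finset.sum_filter]
  split_ifs with h
  · refine Finset.sum_congr rfl fun w hw => ?_
    simp only [key u hu w hw, h, true_and]
    by_cases h1 : v ∪ w ∈ X.cells 2
    · simp only [h1, if_true, true_and]
      rfl
    · simp [h1]
  · symm
    refine Finset.sum_eq_zero fun w hw => ?_
    rw [if_neg]
    rw [key u hu w hw]
    tauto

theorem sum_vertices_adjForm_link (X : WeightedComplex V) (hr : 3 ≤ X.rank) (f : Finset V → ℝ) :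
    ∑ v : {v // v ∈ X.cells 1}, (X.link v.1 (mem_cells.mp v.2).1).adjForm f = X.adjForm f := by
  rw [Finset.sum_congr rfl fun v _ => X.adjForm_link v.2 f]
  rw [Finset.sum_coe_sort (X.cells 1) fun v => ∑ u ∈ X.cells 1, ∑ w ∈ X.cells 1,
      if v ∪ (u ∪ w) ∈ X.cells 3 then X.weight (v ∪ (u ∪ w)) * (f u * f w) else 0,
    Finset.sum_comm, adjForm]
  refine Finset.sum_congr rfl fun u hu => ?_
  rw [Finset.sum_comm]
  refine Finset.sum_congr rfl fun w hw => ?_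
  split_ifs with h
  · rw [← X.sum_union_vertex h (by omega), Finset.sum_mul]
    refine Finset.sum_congr rfl fun v _ => ?_
    split_ifs <;> simp
  · refine Finset.sum_eq_zero fun v hv => ?_
    rw [if_neg]
    intro h1
    apply h
    have e1 := Finset.card_union_le v (u ∪ w)
    have e2 := Finset.card_union_le u w
    have hv1 := (mem_cells.mp hv).2
    have hu1 := (mem_cells.mp hu).2
    have hw1 := (mem_cells.mp hw).2
    obtain ⟨h2, h3⟩ := mem_cells.mp h1
    exact mem_cells.mpr ⟨X.down_closed _ h2 _ subset_union_right, by omega⟩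

theorem sum_vertices_link (X : WeightedComplex V) (hr : 2 ≤ X.rank) (g : Finset V → ℝ) :
    ∑ v : {v // v ∈ X.cells 1}, ∑ u ∈ (X.link v.1 (mem_cells.mp v.2).1).cells 1,
      (X.link v.1 (mem_cells.mp v.2).1).weight u * g u = ∑ u ∈ X.cells 1, X.weight u * g u := by
  have h1 : ∀ v : {v // v ∈ X.cells 1}, ∑ u ∈ (X.link v.1 (mem_cells.mp v.2).1).cells 1,
      (X.link v.1 (mem_cells.mp v.2).1).weight u * g u =
      ∑ u ∈ X.cells 1, if v.1 ∪ u ∈ X.cells 2 then X.weight (v.1 ∪ u) * g u else 0 := by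
    intro v
    rw [link_cells_one X v.2, Finset.sum_filter]
    rfl
  simp only [h1]
  rw [Finset.sum_coe_sort (X.cells 1) fun v => ∑ u ∈ X.cells 1,
    if v ∪ u ∈ X.cells 2 then X.weight (v ∪ u) * g u else 0, Finset.sum_comm]
  refine Finset.sum_congr rfl fun u hu => ?_
  rw [← X.sum_union_vertex hu (by omega), Finset.sum_mul]
  refine Finset.sum_congr rfl fun v _ => ?_
  split_ifs <;> simp

/-- One step of the descent from links to the complex: averaging the quadratic forms of the links
of the vertices bounds the nontrivial eigenvalues of the walk. -/
theorem eigen_le_of_link_bounds (X : WeightedComplex V) (hr : 3 ≤ X.rank) {κ : ℝ} (hκ : κ < 1)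
    (hl : ∀ v (hv : v ∈ X.cells 1), (X.link v (mem_cells.mp hv).1).HasWalkBound κ)
    {x : ℝ} {f : Finset V → ℝ} {v : Finset V} (hf : X.IsWalkEigen x f) (hv : v ∈ X.cells 1)
    (hfv : f v ≠ 0) (hx : x < 1) : x ≤ κ / (1 - κ) := by
  have h3 : 0 < ∑ u ∈ X.cells 1, X.weight u * f u ^ 2 := by
    refine Finset.sum_pos' (fun u hu => ?_) ⟨v, hv, ?_⟩
    · have := weight_pos_of_mem_cells hu
      positivity
    · have := weight_pos_of_mem_cells hv
      positivity
  have h1 : X.adjForm f ≤ κ * ∑ u ∈ X.cells 1, X.weight u * f u ^ 2 +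
      (1 - κ) * (x ^ 2 * ∑ u ∈ X.cells 1, X.weight u * f u ^ 2) := by
    rw [← X.sum_vertices_adjForm_link hr, ← X.sum_vertices_link (by omega) fun u => f u ^ 2,
      Finset.mul_sum]
    refine (Finset.sum_le_sum fun v _ => hl v.1 v.2 f).trans (le_of_eq ?_)
    rw [Finset.sum_add_distrib]
    congr 1
    rw [X.sum_vertices_link (by omega) fun u => f u ^ 2, ← Finset.sum_coe_sort (X.cells 1),
      Finset.mul_sum, Finset.mul_sum]
    refine Finset.sum_congr rfl fun v _ => ?_
    have h2 : ∑ u ∈ (X.link v.1 (mem_cells.mp v.2).1).cells 1,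
        (X.link v.1 (mem_cells.mp v.2).1).weight u * f u = x * (X.weight v.1 * f v.1) := by
      rw [← hf v.1 v.2, link_cells_one X v.2, Finset.sum_filter]
      rfl
    have hw : (X.link v.1 (mem_cells.mp v.2).1).weight ∅ = X.weight v.1 := by simp [link]
    have hwp := weight_pos_of_mem_cells v.2
    rw [h2, hw]
    field_simp
  rw [hf.adjForm_eq] at h1
  have h4 : x ≤ κ + (1 - κ) * x ^ 2 := by
    refine le_of_mul_le_mul_right ?_ h3
    linarith
  rw [le_div_iff₀ (by linarith)]
  nlinarith

/-- If all links of positive dimension are connected and the one-dimensional links have spectral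
gap at least `1 - θ`, then the walk on a complex with `k + 2` vertices in each maximal simplex is
bounded by `θ / (1 - k θ)`. -/
theorem hasWalkBound_of_rank (k : ℕ) : ∀ (X : WeightedComplex V) (θ : ℝ), X.rank = k + 2 →
    0 ≤ θ → (k : ℝ) * θ < 1 →
    (∀ (τ : Finset V) (hτ : τ ∈ X.faces), 2 ≤ (X.link τ hτ).rank →
      (X.link τ hτ).oneSkeleton.Connected) →
    (∀ (τ : Finset V) (hτ : τ ∈ X.faces), (X.link τ hτ).rank = 2 →
      1 - θ ≤ (X.link τ hτ).spectralGap) → X.HasWalkBound (θ / (1 - k * θ)) := by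
  induction k with
  | zero =>
    intro X θ hr hθ _ hc hs
    have hc' := hc ∅ X.empty_mem
    have hs' := hs ∅ X.empty_mem
    rw [link_empty] at hc' hs'
    refine X.hasWalkBound_of_eigen hr.ge (hc' hr.ge) ?_
    intro x f v hf hv hfv hx
    have h1 : X.spectralGap ≤ 1 - x :=
      csInf_le ⟨0, fun μ hμ => hμ.1.le⟩ ⟨by linarith, hf.hasEigenvalue hv hfv⟩
    have := hs' hr
    simp only [Nat.cast_zero, zero_mul, sub_zero, div_one]
    linarith
  | succ k ih =>
    intro X θ hr hθ hk hc hs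
    push_cast at hk
    have hc' := hc ∅ X.empty_mem
    rw [link_empty] at hc'
    refine X.hasWalkBound_of_eigen (by omega) (hc' (by omega)) ?_
    intro x f v hf hv hfv hx
    have hk' : (k : ℝ) * θ < 1 := by nlinarith
    have hκ : θ / (1 - k * θ) < 1 := by
      rw [div_lt_one (by linarith)]
      linarith
    have h1 := X.eigen_le_of_link_bounds (by omega) hκ ?_ hf hv hfv hx
    · refine h1.trans (le_of_eq ?_)
      have e1 : (1 - k * θ) ≠ 0 := by linarith
      have e3 : 1 - θ / (1 - k * θ) = (1 - (k + 1) * θ) / (1 - k * θ) := by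
        rw [eq_div_iff e1, sub_mul, div_mul_cancel₀ _ e1]
        ring
      push_cast
      rw [e3, div_div_div_cancel_right₀ e1]
    · intro w hw
      refine ih _ θ ?_ hθ hk' ?_ ?_
      · have := (mem_cells.mp hw).2
        change X.rank - w.card = _
        omega
      · intro τ hτ hrk
        have hu := (Finset.mem_filter.mp hτ).2.2
        rw [X.link_link _ hτ hu] at hrk ⊢
        exact hc _ hu hrk
      · intro τ hτ hrk
        have hu := (Finset.mem_filter.mp hτ).2.2
        rw [X.link_link _ hτ hu] at hrk ⊢
        exact hs _ hu hrk

/-! ### Sets of simplices, their degrees, and pairs of adjacent simplices -/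

/-- The total weight of a set of simplices. -/
noncomputable def mass (X : WeightedComplex V) (A : Finset (Finset V)) : ℝ := ∑ σ ∈ A, X.weight σ

/-- The weight of the simplices in `A` that contain `τ`. -/
noncomputable def degOn (X : WeightedComplex V) (A : Finset (Finset V)) (τ : Finset V) : ℝ :=
  ∑ σ ∈ A with τ ⊆ σ, X.weight σ

/-- The number of elements of `A` contained in `η`. -/
def countIn (A : Finset (Finset V)) (η : Finset V) : ℕ := #{σ ∈ A | σ ⊆ η}

/-- The number of ordered pairs in `A` with union `η` and with intersection in `B`. It is used for
sets `A` of facets of `η`, where the intersections have codimension two. -/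
def pairCount (A B : Finset (Finset V)) (η : Finset V) : ℕ :=
  #{p ∈ A ×ˢ A | p.1 ∪ p.2 = η ∧ p.1 ∩ p.2 ∈ B}

/-- The weight of the ordered pairs in `A` whose union is a simplex with `s` vertices and whose
intersection is in `B`. -/
noncomputable def pairMass (X : WeightedComplex V) (A B : Finset (Finset V)) (s : ℕ) : ℝ :=
  ∑ η ∈ X.cells s, X.weight η * pairCount A B η

/-- The weight of the simplices with `s` vertices that contain an odd number of elements
of `A`. -/
noncomputable def oddMass (X : WeightedComplex V) (A : Finset (Finset V)) (s : ℕ) : ℝ :=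
  ∑ η ∈ X.cells s, if Odd (countIn A η) then X.weight η else 0

/-- The simplices `τ` with `t` vertices that are fat: those for which the weight of the elements
of `A` containing `τ` is more than a `δ`-fraction of the weight of `τ`. -/
noncomputable def fat (X : WeightedComplex V) (A : Finset (Finset V)) (δ : ℝ) (t : ℕ) :
    Finset (Finset V) := {τ ∈ X.cells t | δ * X.weight τ < X.degOn A τ}

/-- The simplices with `t` vertices that are not fat. -/
noncomputable def thin (X : WeightedComplex V) (A : Finset (Finset V)) (δ : ℝ) (t : ℕ) :
    Finset (Finset V) := {τ ∈ X.cells t | ¬ δ * X.weight τ < X.degOn A τ}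

theorem fat_subset (X : WeightedComplex V) (A : Finset (Finset V)) (δ : ℝ) (t : ℕ) :
    X.fat A δ t ⊆ X.cells t := Finset.filter_subset _ _

theorem thin_subset (X : WeightedComplex V) (A : Finset (Finset V)) (δ : ℝ) (t : ℕ) :
    X.thin A δ t ⊆ X.cells t := Finset.filter_subset _ _

theorem mass_nonneg {X : WeightedComplex V} {A : Finset (Finset V)} {r : ℕ}
    (hA : A ⊆ X.cells r) : 0 ≤ X.mass A :=
  Finset.sum_nonneg fun _ hσ => (weight_pos_of_mem_cells (hA hσ)).le

theorem degOn_nonneg {X : WeightedComplex V} {A : Finset (Finset V)} {r : ℕ}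
    (hA : A ⊆ X.cells r) (τ : Finset V) : 0 ≤ X.degOn A τ :=
  Finset.sum_nonneg fun _ hσ =>
    (weight_pos_of_mem_cells (hA (Finset.mem_filter.mp hσ).1)).le

theorem degOn_empty (X : WeightedComplex V) (A : Finset (Finset V)) : X.degOn A ∅ = X.mass A := by
  simp [degOn, mass]

theorem sum_degOn (X : WeightedComplex V) (A B : Finset (Finset V)) :
    ∑ τ ∈ B, X.degOn A τ = ∑ σ ∈ A, X.weight σ * countIn B σ := by
  simp only [degOn, Finset.sum_filter]
  rw [Finset.sum_comm]
  refine Finset.sum_congr rfl fun σ _ => ?_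
  rw [← Finset.sum_filter, Finset.sum_const, nsmul_eq_mul, mul_comm, countIn]

/-- Each weighted sum over simplices can be distributed over the simplices of the next
dimension. -/
theorem sum_weight_mul (X : WeightedComplex V) {A : Finset (Finset V)} {r : ℕ}
    (hA : A ⊆ X.cells r) (hr : r < X.rank) (g : Finset V → ℝ) :
    ∑ σ ∈ A, X.weight σ * g σ = ∑ η ∈ X.cells (r + 1), X.weight η * ∑ σ ∈ A with σ ⊆ η, g σ := by
  calc ∑ σ ∈ A, X.weight σ * g σ
      = ∑ σ ∈ A, ∑ η ∈ X.cells (r + 1), if σ ⊆ η then X.weight η * g σ else 0 := by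
        refine Finset.sum_congr rfl fun σ hσ => ?_
        rw [← X.sum_cofaces (hA hσ) hr, Finset.sum_mul, Finset.sum_filter]
    _ = _ := by
        rw [Finset.sum_comm]
        refine Finset.sum_congr rfl fun η _ => ?_
        rw [Finset.mul_sum, ← Finset.sum_filter]

theorem mass_eq_sum_countIn (X : WeightedComplex V) {A : Finset (Finset V)} {r : ℕ}
    (hA : A ⊆ X.cells r) (hr : r < X.rank) :
    X.mass A = ∑ η ∈ X.cells (r + 1), X.weight η * countIn A η := by
  have := X.sum_weight_mul hA hr fun _ => 1
  simpa [mass, countIn] using this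

theorem countIn_le {X : WeightedComplex V} {A : Finset (Finset V)} {r : ℕ} (hA : A ⊆ X.cells r)
    {η : Finset V} (hη : η.card = r + 1) : countIn A η ≤ r + 1 := by
  calc countIn A η ≤ #(η.powersetCard r) := by
        refine Finset.card_le_card fun σ hσ => ?_
        rw [Finset.mem_filter] at hσ
        exact Finset.mem_powersetCard.mpr ⟨hσ.2, (mem_cells.mp (hA hσ.1)).2⟩
    _ = r + 1 := by rw [Finset.card_powersetCard, hη, Nat.choose_succ_self_right]

theorem pairCount_eq_sum (A B : Finset (Finset V)) (η : Finset V) :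
    pairCount A B η = ∑ τ ∈ B, pairCount A {τ} η := by
  rw [pairCount, Finset.card_eq_sum_card_fiberwise (f := fun p => p.1 ∩ p.2) (t := B)
    fun p hp => (Finset.mem_filter.mp hp).2.2]
  refine Finset.sum_congr rfl fun τ hτ => ?_
  rw [pairCount, Finset.filter_filter]
  congr 1
  refine Finset.filter_congr fun p _ => ?_
  rw [Finset.mem_singleton]
  constructor
  · tauto
  · rintro ⟨h1, rfl⟩
    exact ⟨⟨h1, hτ⟩, rfl⟩

theorem pairMass_eq_sum (X : WeightedComplex V) (A B : Finset (Finset V)) (s : ℕ) :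
    X.pairMass A B s = ∑ τ ∈ B, X.pairMass A {τ} s := by
  simp only [pairMass]
  rw [Finset.sum_comm]
  refine Finset.sum_congr rfl fun η _ => ?_
  rw [← Finset.mul_sum, pairCount_eq_sum A B]
  push_cast
  rfl

theorem pairMass_eq (X : WeightedComplex V) (A B : Finset (Finset V)) (s : ℕ) :
    X.pairMass A B s = ∑ σ ∈ A, ∑ σ' ∈ A,
      if σ ∪ σ' ∈ X.cells s ∧ σ ∩ σ' ∈ B then X.weight (σ ∪ σ') else 0 := by
  rw [← Finset.sum_product']
  calc X.pairMass A B s = ∑ η ∈ X.cells s, ∑ p ∈ A ×ˢ A,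
        if p.1 ∪ p.2 = η ∧ p.1 ∩ p.2 ∈ B then X.weight η else 0 := by
        refine Finset.sum_congr rfl fun η _ => ?_
        rw [← Finset.sum_filter, Finset.sum_const, nsmul_eq_mul, mul_comm, pairCount]
    _ = _ := by
        rw [Finset.sum_comm]
        refine Finset.sum_congr rfl fun p _ => ?_
        simp only [ite_and]
        rw [Finset.sum_ite_eq]

/-- The expander mixing lemma in the link of `τ`: a set of cofaces of `τ` of small relative weight
has few adjacent pairs. -/
theorem pairMass_singleton_le (X : WeightedComplex V) {τ : Finset V} {t : ℕ} (hτ : τ ∈ X.cells t)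
    {κ : ℝ} (hκ : 0 ≤ κ) (hW : (X.link τ (mem_cells.mp hτ).1).HasWalkBound κ)
    {A : Finset (Finset V)} (hA : A ⊆ X.cells (t + 1)) :
    X.pairMass A {τ} (t + 2) ≤ X.degOn A τ * (κ + X.degOn A τ / X.weight τ) := by
  set Y := X.link τ (mem_cells.mp hτ).1 with hY
  have hτc := (mem_cells.mp hτ).2
  have hfilt : {σ ∈ X.cells (t + 1) | τ ⊆ σ}.filter (· ∈ A) = {σ ∈ A | τ ⊆ σ} := by
    ext σ
    simp only [Finset.mem_filter]
    constructor
    · tauto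
    · rintro ⟨h1, h2⟩
      exact ⟨⟨hA h1, h2⟩, h1⟩
  have h1 : ∑ u ∈ Y.cells 1, Y.weight u * (if τ ∪ u ∈ A then (1 : ℝ) else 0) = X.degOn A τ := by
    have := X.sum_link_cells hτ 1 fun σ => X.weight σ * if σ ∈ A then (1 : ℝ) else 0
    refine this.trans ?_
    simp only [mul_ite, mul_one, mul_zero]
    rw [← Finset.sum_filter, hfilt]
    rfl
  have h2 : Y.adjForm (fun u => if τ ∪ u ∈ A then (1 : ℝ) else 0) = X.pairMass A {τ} (t + 2) := by
    have e1 : ∀ u ∈ Y.cells 1, ∀ w ∈ Y.cells 1,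
        (u ∪ w ∈ Y.cells 2 ↔ (τ ∪ u) ∪ (τ ∪ w) ∈ X.cells (t + 2)) := by
      intro u hu w hw
      rw [← Finset.union_union_distrib_left]
      rw [hY, mem_link_cells] at hu hw ⊢
      have hd : Disjoint τ (u ∪ w) := Finset.disjoint_union_right.mpr ⟨hu.1, hw.1⟩
      rw [mem_cells, Finset.card_union_of_disjoint hd, hτc]
      constructor
      · rintro ⟨-, h, h'⟩
        exact ⟨h, by omega⟩
      · rintro ⟨h, h'⟩
        exact ⟨hd, h, by omega⟩
    have e2 : Y.adjForm (fun u => if τ ∪ u ∈ A then (1 : ℝ) else 0) =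
        ∑ u ∈ Y.cells 1, ∑ w ∈ Y.cells 1,
          if (τ ∪ u) ∪ (τ ∪ w) ∈ X.cells (t + 2) then X.weight ((τ ∪ u) ∪ (τ ∪ w)) *
            ((if τ ∪ u ∈ A then (1 : ℝ) else 0) * (if τ ∪ w ∈ A then (1 : ℝ) else 0)) else 0 := by
      refine Finset.sum_congr rfl fun u hu => Finset.sum_congr rfl fun w hw => ?_
      simp only [e1 u hu w hw, ← Finset.union_union_distrib_left]
      rfl
    rw [e2, pairMass_eq]
    have e3 := fun u => X.sum_link_cells hτ 1 fun σ' =>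
      if (τ ∪ u) ∪ σ' ∈ X.cells (t + 2) then X.weight ((τ ∪ u) ∪ σ') *
            ((if τ ∪ u ∈ A then (1 : ℝ) else 0) * (if σ' ∈ A then (1 : ℝ) else 0)) else 0
    rw [Finset.sum_congr rfl fun u _ => e3 u]
    rw [X.sum_link_cells hτ 1 fun σ => ∑ σ' ∈ X.cells (t + 1) with τ ⊆ σ',
      if σ ∪ σ' ∈ X.cells (t + 2) then X.weight (σ ∪ σ') *
            ((if σ ∈ A then (1 : ℝ) else 0) * (if σ' ∈ A then (1 : ℝ) else 0)) else 0]
    have e4 : ∀ σ ∈ A, ∀ σ' ∈ A, (σ ∪ σ' ∈ X.cells (t + 2) ∧ σ ∩ σ' ∈ ({τ} : Finset (Finset V)) ↔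
        (τ ⊆ σ ∧ τ ⊆ σ') ∧ σ ∪ σ' ∈ X.cells (t + 2)) := by
      intro σ hσ σ' hσ'
      rw [Finset.mem_singleton]
      constructor
      · rintro ⟨h, rfl⟩
        exact ⟨⟨inter_subset_left, inter_subset_right⟩, h⟩
      · rintro ⟨⟨h, h'⟩, hu⟩
        refine ⟨hu, (Finset.eq_of_subset_of_card_le (Finset.subset_inter h h') ?_).symm⟩
        have c1 := (mem_cells.mp (hA hσ)).2
        have c2 := (mem_cells.mp (hA hσ')).2
        have c3 := (mem_cells.mp hu).2
        have := Finset.card_union_add_card_inter σ σ'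
        omega
    symm
    rw [Finset.sum_congr rfl fun σ hσ => Finset.sum_congr rfl fun σ' hσ' =>
      if_congr (e4 σ hσ σ' hσ') rfl rfl]
    simp only [ite_and]
    have e5 : ∀ (g : Finset V → ℝ), ∑ σ ∈ X.cells (t + 1) with τ ⊆ σ,
        (if σ ∈ A then g σ else 0) = ∑ σ ∈ A, if τ ⊆ σ then g σ else 0 := by
      intro g
      rw [← Finset.sum_filter, hfilt, Finset.sum_filter]
    rw [Finset.sum_congr rfl fun σ (_ : σ ∈ {σ ∈ X.cells (t + 1) | τ ⊆ σ}) => (?_ : _ =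
      if σ ∈ A then ∑ σ' ∈ A, if τ ⊆ σ' then
        (if σ ∪ σ' ∈ X.cells (t + 2) then X.weight (σ ∪ σ') else 0) else 0 else 0)]
    · rw [e5]
      refine Finset.sum_congr rfl fun σ _ => ?_
      split_ifs
      · rfl
      · exact Finset.sum_const_zero
    · split_ifs with hσ
      · rw [← e5]
        refine Finset.sum_congr rfl fun σ' _ => ?_
        split_ifs <;> simp
      · simp
  have h3 := hW fun u => if τ ∪ u ∈ A then (1 : ℝ) else 0
  have h4 : ∀ u, (if τ ∪ u ∈ A then (1 : ℝ) else 0) ^ 2 = if τ ∪ u ∈ A then 1 else 0 := by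
    intro u
    split_ifs <;> simp
  simp only [h4] at h3
  rw [h2, h1] at h3
  have hw : Y.weight ∅ = X.weight τ := by simp [hY, link]
  have hwp := weight_pos_of_mem_cells hτ
  rw [hw] at h3
  have h5 : 0 ≤ κ * (X.degOn A τ ^ 2 / X.weight τ) := by positivity
  have h6 : (1 - κ) * X.degOn A τ ^ 2 / X.weight τ =
    X.degOn A τ * (X.degOn A τ / X.weight τ) - κ * (X.degOn A τ ^ 2 / X.weight τ) := by ring
  rw [mul_add]
  linarith

theorem sum_cells_degOn_le (X : WeightedComplex V) {A B : Finset (Finset V)} {t : ℕ}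
    (hA : A ⊆ X.cells (t + 1)) (hB : B ⊆ X.cells t) :
    ∑ τ ∈ B, X.degOn A τ ≤ (t + 1) * X.mass A := by
  rw [sum_degOn, mass, Finset.mul_sum]
  refine Finset.sum_le_sum fun σ hσ => ?_
  rw [mul_comm]
  have h1 : countIn B σ ≤ t + 1 := countIn_le hB (mem_cells.mp (hA hσ)).2
  have h2 : (countIn B σ : ℝ) ≤ t + 1 := by exact_mod_cast h1
  exact mul_le_mul_of_nonneg_right h2 (weight_pos_of_mem_cells (hA hσ)).le

theorem mass_fat_le (X : WeightedComplex V) {A : Finset (Finset V)} {t : ℕ}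
    (hA : A ⊆ X.cells (t + 1)) (δ : ℝ) :
    δ * X.mass (X.fat A δ t) ≤ (t + 1) * X.mass A := by
  refine le_trans ?_ (X.sum_cells_degOn_le hA (X.fat_subset A δ t))
  rw [mass, Finset.mul_sum]
  exact Finset.sum_le_sum fun τ hτ => (Finset.mem_filter.mp hτ).2.le

theorem pairMass_thin_le (X : WeightedComplex V) {t : ℕ} {κ : ℝ} (hκ : 0 ≤ κ)
    (hW : ∀ τ (hτ : τ ∈ X.cells t), (X.link τ (mem_cells.mp hτ).1).HasWalkBound κ)
    {A : Finset (Finset V)} (hA : A ⊆ X.cells (t + 1)) {δ : ℝ} (hδ : 0 ≤ δ) :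
    X.pairMass A (X.thin A δ t) (t + 2) ≤ (κ + δ) * ((t + 1) * X.mass A) := by
  rw [pairMass_eq_sum]
  calc _ ≤ ∑ τ ∈ X.thin A δ t, (κ + δ) * X.degOn A τ := by
        refine Finset.sum_le_sum fun τ hτ => ?_
        obtain ⟨h1, h2⟩ := Finset.mem_filter.mp hτ
        have hwp := weight_pos_of_mem_cells h1
        refine (X.pairMass_singleton_le h1 hκ (hW τ h1) hA).trans ?_
        rw [mul_comm]
        refine mul_le_mul_of_nonneg_right ?_ (degOn_nonneg hA τ)
        have : X.degOn A τ / X.weight τ ≤ δ := (div_le_iff₀ hwp).mpr (not_lt.mp h2)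
        linarith
    _ ≤ _ := by
        rw [← Finset.mul_sum]
        exact mul_le_mul_of_nonneg_left (X.sum_cells_degOn_le hA (X.thin_subset A δ t))
          (by linarith)

theorem pairMass_fat_le (X : WeightedComplex V) {t : ℕ} {κ : ℝ} (hκ : 0 ≤ κ)
    (hW : ∀ τ (hτ : τ ∈ X.cells t), (X.link τ (mem_cells.mp hτ).1).HasWalkBound κ)
    {A : Finset (Finset V)} (hA : A ⊆ X.cells (t + 1)) {δ c : ℝ}
    (hc : ∀ τ ∈ X.cells t, X.degOn A τ ≤ c * X.weight τ) :
    X.pairMass A (X.fat A δ t) (t + 2) ≤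
      (κ + c) * ∑ σ ∈ A, X.weight σ * countIn (X.fat A δ t) σ := by
  rw [pairMass_eq_sum, ← sum_degOn, Finset.mul_sum]
  refine Finset.sum_le_sum fun τ hτ => ?_
  have h1 := X.fat_subset _ _ _ hτ
  have hwp := weight_pos_of_mem_cells h1
  refine (X.pairMass_singleton_le h1 hκ (hW τ h1) hA).trans ?_
  rw [mul_comm]
  refine mul_le_mul_of_nonneg_right ?_ (degOn_nonneg hA τ)
  have : X.degOn A τ / X.weight τ ≤ c := (div_le_iff₀ hwp).mpr (hc τ h1)
  linarith

theorem pairMass_fat_add_thin (X : WeightedComplex V) (A C : Finset (Finset V)) (δ : ℝ) (t s : ℕ) :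
    X.pairMass C (X.fat A δ t) s + X.pairMass C (X.thin A δ t) s =
      X.pairMass C (X.cells t) s := by
  rw [pairMass_eq_sum X C (X.fat A δ t), pairMass_eq_sum X C (X.thin A δ t),
    pairMass_eq_sum X C (X.cells t)]
  exact Finset.sum_filter_add_sum_filter_not _ _ _

theorem pair_of_ne {X : WeightedComplex V} {η σ σ' : Finset V} {t : ℕ} (hη : η ∈ X.cells (t + 2))
    (h1 : σ ∈ X.cells (t + 1)) (h2 : σ' ∈ X.cells (t + 1)) (hs : σ ⊆ η) (hs' : σ' ⊆ η)
    (hne : σ ≠ σ') : σ ∪ σ' = η ∧ σ ∩ σ' ∈ X.cells t := by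
  have c1 := (mem_cells.mp h1).2
  have c2 := (mem_cells.mp h2).2
  have c3 := (mem_cells.mp hη).2
  have c4 := Finset.card_union_add_card_inter σ σ'
  have hlt : σ.card < (σ ∪ σ').card := by
    refine Finset.card_lt_card ⟨subset_union_left, fun h => hne ?_⟩
    exact (Finset.eq_of_subset_of_card_le (subset_union_right.trans h) (by omega)).symm
  have hu : σ ∪ σ' = η := Finset.eq_of_subset_of_card_le (Finset.union_subset hs hs') (by omega)
  refine ⟨hu, mem_cells.mpr ⟨X.down_closed _ (mem_cells.mp h1).1 _ inter_subset_left, ?_⟩⟩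
  rw [hu] at c4
  omega

/-- Two different facets of a simplex are adjacent. -/
theorem countIn_sq_le (X : WeightedComplex V) {A : Finset (Finset V)} {t : ℕ}
    (hA : A ⊆ X.cells (t + 1)) {η : Finset V} (hη : η ∈ X.cells (t + 2)) :
    countIn A η * countIn A η ≤ pairCount A (X.cells t) η + countIn A η := by
  have h1 : #({σ ∈ A | σ ⊆ η}.offDiag) ≤ pairCount A (X.cells t) η := by
    refine Finset.card_le_card fun p hp => ?_
    simp only [Finset.mem_offDiag, Finset.mem_filter, Finset.mem_product] at hp ⊢
    obtain ⟨⟨h1, h2⟩, ⟨h3, h4⟩, h5⟩ := hp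
    exact ⟨⟨h1, h3⟩, pair_of_ne hη (hA h1) (hA h3) h2 h4 h5⟩
  rw [Finset.offDiag_card] at h1
  change countIn A η * countIn A η - countIn A η ≤ _ at h1
  omega

/-- As `k - k (k - 1) ≤ 1`, and `k - k (k - 1) ≤ 0` for even `k`, the weight of the simplices with
an odd number of facets in `A` is at least the weight of `A` minus the weight of the
adjacent pairs in `A`. -/
theorem mass_sub_pairMass_le (X : WeightedComplex V) {A : Finset (Finset V)} {t : ℕ}
    (hA : A ⊆ X.cells (t + 1)) (hr : t + 1 < X.rank) :
    X.mass A - X.pairMass A (X.cells t) (t + 2) ≤ X.oddMass A (t + 2) := by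
  rw [X.mass_eq_sum_countIn hA hr, pairMass, ← Finset.sum_sub_distrib]
  refine Finset.sum_le_sum fun η hη => ?_
  have h1 := X.countIn_sq_le hA hη
  have hw := weight_pos_of_mem_cells hη
  rw [← mul_sub]
  by_cases h : Odd (countIn A η)
  · rw [if_pos h]
    have h2 : countIn A η ≤ pairCount A (X.cells t) η + 1 := by
      rcases Nat.lt_or_ge (countIn A η) 2 with h3 | h3
      · omega
      · nlinarith
    have h3 : (countIn A η : ℝ) ≤ pairCount A (X.cells t) η + 1 := by exact_mod_cast h2
    nlinarith
  · rw [if_neg h]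
    have h2 : countIn A η ≤ pairCount A (X.cells t) η := by
      rcases Nat.lt_or_ge (countIn A η) 2 with h3 | h3
      · have : countIn A η ≠ 1 := by
          rintro h4
          rw [h4] at h
          exact h odd_one
        omega
      · nlinarith
    have h3 : (countIn A η : ℝ) ≤ pairCount A (X.cells t) η := by exact_mod_cast h2
    nlinarith

/-- `m(∅) = r! m(X^{(r-1)})`, in recursive form. -/
theorem totalWeight_succ (X : WeightedComplex V) {r : ℕ} (hr : r < X.rank) :
    X.totalWeight r = (r + 1) * X.totalWeight (r + 1) := by
  have h := X.mass_eq_sum_countIn (Finset.Subset.refl (X.cells r)) hr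
  change X.totalWeight r = _ at h
  rw [h, totalWeight, Finset.mul_sum]
  refine Finset.sum_congr rfl fun η hη => ?_
  obtain ⟨h1, h2⟩ := mem_cells.mp hη
  have : countIn (X.cells r) η = r + 1 := by
    have : {σ ∈ X.cells r | σ ⊆ η} = η.powersetCard r := by
      ext σ
      rw [Finset.mem_filter, Finset.mem_powersetCard, mem_cells]
      constructor
      · tauto
      · rintro ⟨h3, h4⟩
        exact ⟨⟨X.down_closed _ h1 _ h3, h4⟩, h3⟩
    rw [countIn, this, Finset.card_powersetCard, h2, Nat.choose_succ_self_right]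
  rw [this]
  push_cast
  ring

/-! ### Supports of cochains -/

/-- The set of simplices on which a cochain is nonzero. -/
noncomputable def supp (X : WeightedComplex V) {r : ℕ} (φ : X.Cochain r) : Finset (Finset V) :=
  {σ ∈ X.cells r | ∃ h, φ ⟨σ, h⟩ = 1}

theorem mem_supp {X : WeightedComplex V} {r : ℕ} {φ : X.Cochain r} {σ : Finset V} :
    σ ∈ X.supp φ ↔ ∃ h, φ ⟨σ, h⟩ = 1 := by
  rw [supp, Finset.mem_filter]
  exact ⟨fun h => h.2, fun h => ⟨h.1, h⟩⟩

theorem coe_mem_supp {X : WeightedComplex V} {r : ℕ} {φ : X.Cochain r}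
    {σ : {σ // σ ∈ X.cells r}} : σ.1 ∈ X.supp φ ↔ φ σ = 1 := by
  rw [mem_supp]
  exact ⟨fun h => h.2, fun h => ⟨σ.2, h⟩⟩

theorem supp_subset (X : WeightedComplex V) {r : ℕ} (φ : X.Cochain r) : X.supp φ ⊆ X.cells r :=
  Finset.filter_subset _ _

theorem cnorm_eq_sum (X : WeightedComplex V) {r : ℕ} (φ : X.Cochain r) :
    X.cnorm φ = ∑ σ ∈ X.cells r, if σ ∈ X.supp φ then X.weight σ else 0 := by
  rw [← Finset.sum_coe_sort (X.cells r)]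
  simp only [cnorm, coe_mem_supp]

theorem cnorm_eq_mass (X : WeightedComplex V) {r : ℕ} (φ : X.Cochain r) :
    X.cnorm φ = X.mass (X.supp φ) := by
  rw [cnorm_eq_sum, ← Finset.sum_filter, mass]
  refine Finset.sum_congr ?_ fun _ _ => rfl
  ext σ
  rw [Finset.mem_filter]
  exact ⟨fun h => h.2, fun h => ⟨X.supp_subset φ h, h⟩⟩

theorem cnorm_nonneg (X : WeightedComplex V) {r : ℕ} (φ : X.Cochain r) : 0 ≤ X.cnorm φ := by
  rw [cnorm_eq_mass]
  exact mass_nonneg (X.supp_subset φ)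

theorem zmod_two_eq_ite (a : ZMod 2) : a = if a = 1 then 1 else 0 := by
  fin_cases a <;> rfl

theorem supp_nonempty {X : WeightedComplex V} {r : ℕ} {φ : X.Cochain r} (h : φ ≠ 0) :
    (X.supp φ).Nonempty := by
  obtain ⟨σ, hσ⟩ := Function.ne_iff.mp h
  refine ⟨σ.1, coe_mem_supp.mpr ?_⟩
  by_contra h1
  have := zmod_two_eq_ite (φ σ)
  rw [if_neg h1] at this
  exact hσ this

theorem cnorm_pos {X : WeightedComplex V} {r : ℕ} {φ : X.Cochain r} (h : φ ≠ 0) :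
    0 < X.cnorm φ := by
  rw [cnorm_eq_mass]
  exact Finset.sum_pos (fun σ hσ => weight_pos_of_mem_cells (X.supp_subset φ hσ))
    (supp_nonempty h)

theorem d_eq_one_iff (X : WeightedComplex V) {r : ℕ} (φ : X.Cochain r)
    (η : {σ // σ ∈ X.cells (r + 1)}) : X.d r φ η = 1 ↔ Odd (countIn (X.supp φ) η.1) := by
  have h1 : X.d r φ η = (countIn (X.supp φ) η.1 : ZMod 2) := by
    calc X.d r φ η = ∑ τ : {τ // τ ∈ X.cells r},
          if τ.1 ⊆ η.1 then (if τ.1 ∈ X.supp φ then 1 else 0) else 0 := by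
          refine Finset.sum_congr rfl fun τ _ => ?_
          simp only [coe_mem_supp, ← zmod_two_eq_ite]
      _ = ∑ τ ∈ X.cells r, if τ ⊆ η.1 then (if τ ∈ X.supp φ then 1 else 0) else 0 :=
          Finset.sum_coe_sort (X.cells r)
            fun τ => if τ ⊆ η.1 then (if τ ∈ X.supp φ then (1 : ZMod 2) else 0) else 0
      _ = _ := by
          rw [← Finset.sum_filter, ← Finset.sum_filter, Finset.sum_const, nsmul_eq_mul, mul_one,
            Finset.filter_filter, countIn]
          congr 2
          ext σ
          rw [Finset.mem_filter, Finset.mem_filter]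
          exact ⟨fun h => ⟨h.2.2, h.2.1⟩, fun h => ⟨X.supp_subset φ h.1, h.2, h.1⟩⟩
  rw [h1]
  exact ZMod.natCast_eq_one_iff_odd

theorem cnorm_d (X : WeightedComplex V) {r : ℕ} (φ : X.Cochain r) :
    X.cnorm (X.d r φ) = X.oddMass (X.supp φ) (r + 1) := by
  rw [oddMass, ← Finset.sum_coe_sort (X.cells (r + 1))]
  simp only [cnorm, d_eq_one_iff]

theorem cnorm_d_le (X : WeightedComplex V) {r : ℕ} (hr : r < X.rank) (φ : X.Cochain r) :
    X.cnorm (X.d r φ) ≤ X.cnorm φ := by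
  rw [cnorm_d, cnorm_eq_mass, X.mass_eq_sum_countIn (X.supp_subset φ) hr]
  refine Finset.sum_le_sum fun η hη => ?_
  have hw := weight_pos_of_mem_cells hη
  split_ifs with h
  · have : (1 : ℝ) ≤ countIn (X.supp φ) η := by exact_mod_cast h.pos
    nlinarith
  · positivity

theorem mem_supp_localize (X : WeightedComplex V) {t s r : ℕ} (h : t + s = r) (φ : X.Cochain r)
    {τ : Finset V} (hτ : τ ∈ X.cells t) {σ : Finset V}
    (hσ : σ ∈ (X.link τ (mem_cells.mp hτ).1).cells s) :
    σ ∈ (X.link τ (mem_cells.mp hτ).1).supp (X.localize h φ τ hτ) ↔ τ ∪ σ ∈ X.supp φ := by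
  rw [mem_supp, mem_supp]
  constructor
  · rintro ⟨h1, h2⟩
    exact ⟨_, h2⟩
  · rintro ⟨h1, h2⟩
    exact ⟨hσ, h2⟩

theorem cnorm_localize (X : WeightedComplex V) {t s r : ℕ} (h : t + s = r) (φ : X.Cochain r)
    {τ : Finset V} (hτ : τ ∈ X.cells t) :
    (X.link τ (mem_cells.mp hτ).1).cnorm (X.localize h φ τ hτ) = X.degOn (X.supp φ) τ := by
  rw [cnorm_eq_sum]
  refine (Finset.sum_congr rfl fun σ hσ =>
    if_congr (X.mem_supp_localize h φ hτ hσ) rfl rfl).trans ?_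
  refine (X.sum_link_cells hτ s fun σ => if σ ∈ X.supp φ then X.weight σ else 0).trans ?_
  rw [← Finset.sum_filter, degOn, h]
  refine Finset.sum_congr ?_ fun _ _ => rfl
  ext σ
  simp only [Finset.mem_filter]
  exact ⟨fun h => ⟨h.2, h.1.2⟩, fun h => ⟨⟨X.supp_subset φ h.1, h.2⟩, h.1⟩⟩

theorem countIn_supp_localize (X : WeightedComplex V) {t s r : ℕ} (h : t + s = r)
    (φ : X.Cochain r) {τ : Finset V} (hτ : τ ∈ X.cells t) (ρ : Finset V) :
    countIn ((X.link τ (mem_cells.mp hτ).1).supp (X.localize h φ τ hτ)) ρ =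
      countIn {σ ∈ X.supp φ | τ ⊆ σ} (τ ∪ ρ) := by
  set Y := X.link τ (mem_cells.mp hτ).1 with hY
  have h1 : countIn (Y.supp (X.localize h φ τ hτ)) ρ =
      ∑ σ ∈ Y.cells s, if τ ∪ σ ∈ X.supp φ ∧ τ ∪ σ ⊆ τ ∪ ρ then 1 else 0 := by
    rw [← Finset.card_filter, countIn]
    congr 1
    ext σ
    rw [Finset.mem_filter, Finset.mem_filter]
    have hsub : ∀ σ ∈ Y.cells s, (σ ⊆ ρ ↔ τ ∪ σ ⊆ τ ∪ ρ) := by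
      intro σ hσ
      rw [hY, mem_link_cells] at hσ
      refine ⟨fun h => union_subset_union_right h, fun h x hx => ?_⟩
      rcases Finset.mem_union.mp (h (Finset.mem_union_right _ hx)) with h1 | h1
      · exact absurd hx (Finset.disjoint_left.mp hσ.1 h1)
      · exact h1
    constructor
    · rintro ⟨h1, h2⟩
      have h3 := Y.supp_subset _ h1
      exact ⟨h3, (X.mem_supp_localize h φ hτ h3).mp h1, (hsub σ h3).mp h2⟩
    · rintro ⟨h3, h1, h2⟩
      exact ⟨(X.mem_supp_localize h φ hτ h3).mpr h1, (hsub σ h3).mpr h2⟩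
  rw [h1, X.sum_link_cells hτ s fun σ => if σ ∈ X.supp φ ∧ σ ⊆ τ ∪ ρ then 1 else 0,
    ← Finset.card_filter, countIn, h]
  congr 1
  ext σ
  simp only [Finset.mem_filter]
  constructor
  · tauto
  · rintro ⟨⟨h1, h2⟩, h3⟩
    exact ⟨⟨X.supp_subset φ h1, h2⟩, h1, h3⟩

theorem cnorm_d_localize (X : WeightedComplex V) {t s r : ℕ} (h : t + s = r) (φ : X.Cochain r)
    {τ : Finset V} (hτ : τ ∈ X.cells t) :
    (X.link τ (mem_cells.mp hτ).1).cnorm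
        ((X.link τ (mem_cells.mp hτ).1).d s (X.localize h φ τ hτ)) =
      ∑ η ∈ X.cells (r + 1), if τ ⊆ η ∧ Odd (countIn {σ ∈ X.supp φ | τ ⊆ σ} η)
        then X.weight η else 0 := by
  rw [cnorm_d, oddMass]
  refine (Finset.sum_congr rfl fun σ hσ =>
    if_congr (by rw [X.countIn_supp_localize h φ hτ σ]) rfl rfl).trans ?_
  refine (X.sum_link_cells hτ (s + 1) fun η =>
    if Odd (countIn {σ ∈ X.supp φ | τ ⊆ σ} η) then X.weight η else 0).trans ?_
  rw [← add_assoc, h, Finset.sum_filter]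
  simp only [ite_and]

/-- Comparison with the constant cochain `1`: in a locally minimal cochain, the simplices through
a face of codimension one carry at most about half of its weight. -/
theorem degOn_le_of_isLocallyMinimal (X : WeightedComplex V) {ε : ℝ} {k : ℕ}
    (hr : k + 1 < X.rank) {φ : X.Cochain (k + 2)} (hφ : X.IsLocallyMinimal ε (k + 1) φ)
    {τ : Finset V} (hτ : τ ∈ X.cells (k + 1)) :
    X.degOn (X.supp φ) τ ≤ (1 + ε) / 2 * X.weight τ := by
  set Y := X.link τ (mem_cells.mp hτ).1 with hY
  have h0 : (fun _ => 1 : Y.Cochain 1) ∈ Y.coboundaries 0 := by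
    refine ⟨fun _ => 1, ?_⟩
    funext v
    rw [d_eq_one_iff]
    have : countIn (Y.supp (fun _ => 1 : Y.Cochain 0)) v.1 = 1 := by
      rw [countIn, Finset.card_eq_one]
      refine ⟨∅, ?_⟩
      ext σ
      rw [Finset.mem_filter, Finset.mem_singleton, mem_supp]
      constructor
      · rintro ⟨⟨h, -⟩, -⟩
        exact Finset.card_eq_zero.mp (mem_cells.mp h).2
      · rintro rfl
        exact ⟨⟨Y.empty_mem_cells, rfl⟩, Finset.empty_subset _⟩
    rw [this]
    exact odd_one
  have h1 := hφ k 0 rfl τ hτ _ h0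
  have h2 : Y.cnorm (X.localize (s := 1) rfl φ τ hτ) +
      Y.cnorm (X.localize (s := 1) rfl φ τ hτ - fun _ => 1) = X.weight τ := by
    have hrk : 0 < Y.rank := by
      have := (mem_cells.mp hτ).2
      change 0 < X.rank - τ.card
      omega
    have hw : Y.weight ∅ = X.weight τ := by simp [hY, link]
    rw [← hw, ← Y.sum_weight_vertices hrk, ← Finset.sum_coe_sort (Y.cells 1), cnorm, cnorm,
      ← Finset.sum_add_distrib]
    refine Finset.sum_congr rfl fun σ _ => ?_
    rw [Pi.sub_apply]
    generalize X.localize (s := 1) rfl φ τ hτ σ = a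
    rcases (by decide : ∀ a : ZMod 2, (a = 1 ∧ a - 1 ≠ 1) ∨ (a ≠ 1 ∧ a - 1 = 1)) a with h | h
    · rw [if_pos h.1, if_neg h.2, add_zero]
    · rw [if_neg h.1, if_pos h.2, zero_add]
  rw [← X.cnorm_localize (s := 1) rfl φ hτ]
  change Y.cnorm (X.localize (s := 1) rfl φ τ hτ) ≤
    Y.cnorm (X.localize (s := 1) rfl φ τ hτ - fun _ => 1) + ε * X.weight τ at h1
  linarith

/-! ### Coboundary expansion -/

theorem distToCoboundaries_nonneg (X : WeightedComplex V) (k : ℕ) (φ : X.Cochain (k + 1)) :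
    0 ≤ X.distToCoboundaries k φ :=
  Real.sInf_nonneg fun _ ⟨_, _, hx⟩ => hx ▸ X.cnorm_nonneg _

theorem coboundaryExpansion_bddBelow (X : WeightedComplex V) (k : ℕ) :
    BddBelow {x : ℝ | ∃ φ : X.Cochain (k + 1), φ ∉ X.coboundaries k ∧
      x = X.cnorm (X.d (k + 1) φ) / X.distToCoboundaries k φ} :=
  ⟨0, fun _ ⟨_, _, hx⟩ =>
    hx ▸ div_nonneg (X.cnorm_nonneg _) (X.distToCoboundaries_nonneg k _)⟩

theorem le_distToCoboundaries (X : WeightedComplex V) {k : ℕ} {φ : X.Cochain (k + 1)} {a : ℝ}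
    (h : ∀ ψ ∈ X.coboundaries k, a ≤ X.cnorm (φ - ψ)) : a ≤ X.distToCoboundaries k φ :=
  le_csInf ⟨_, 0, Submodule.zero_mem _, rfl⟩ fun _ ⟨ψ, hψ, hx⟩ => hx ▸ h ψ hψ

/-- A cochain that is minimal in its class up to an error `a` satisfies the expansion inequality
up to that error. -/
theorem expansion_le_cnorm_d (X : WeightedComplex V) {k : ℕ} {ε a : ℝ} (hε : 0 < ε)
    (hX : ε ≤ X.coboundaryExpansion k) {φ : X.Cochain (k + 1)}
    (hφ : ∀ ψ ∈ X.coboundaries k, X.cnorm φ ≤ X.cnorm (φ - ψ) + a) :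
    ε * (X.cnorm φ - a) ≤ X.cnorm (X.d (k + 1) φ) := by
  by_cases h : φ ∈ X.coboundaries k
  · have h1 := hφ φ h
    have h2 : X.cnorm (φ - φ) = 0 := by simp [cnorm]
    rw [h2] at h1
    have h3 := X.cnorm_nonneg (X.d (k + 1) φ)
    nlinarith
  · have h1 : ε ≤ X.cnorm (X.d (k + 1) φ) / X.distToCoboundaries k φ :=
      hX.trans (csInf_le (X.coboundaryExpansion_bddBelow k) ⟨φ, h, rfl⟩)
    have h2 : X.cnorm φ - a ≤ X.distToCoboundaries k φ :=
      X.le_distToCoboundaries fun ψ hψ => by linarith [hφ ψ hψ]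
    have h3 : 0 < X.distToCoboundaries k φ := by
      refine (X.distToCoboundaries_nonneg k φ).lt_of_ne fun h0 => ?_
      rw [← h0, div_zero] at h1
      linarith
    rw [le_div_iff₀ h3] at h1
    nlinarith

/-- The coboundary expansion is at most `1`, as `‖dφ‖ ≤ ‖φ‖` for a cochain `φ` of minimal norm
among those that are not coboundaries. -/
theorem coboundaryExpansion_le_one (X : WeightedComplex V) {k : ℕ} (hr : k + 1 < X.rank) :
    X.coboundaryExpansion k ≤ 1 := by
  by_cases h : ∃ φ : X.Cochain (k + 1), φ ∉ X.coboundaries k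
  · obtain ⟨φ, hφ, hmin⟩ := Set.exists_min_image {φ : X.Cochain (k + 1) | φ ∉ X.coboundaries k}
      (fun φ => X.cnorm φ) (Set.toFinite _) h
    refine (csInf_le (X.coboundaryExpansion_bddBelow k) ⟨φ, hφ, rfl⟩).trans ?_
    refine div_le_one_of_le₀ ?_ (X.distToCoboundaries_nonneg k φ)
    refine (X.cnorm_d_le hr φ).trans (X.le_distToCoboundaries fun ψ hψ => hmin _ fun h1 => hφ ?_)
    have := Submodule.add_mem _ h1 hψ
    rwa [sub_add_cancel] at this
  · have : {x : ℝ | ∃ φ : X.Cochain (k + 1), φ ∉ X.coboundaries k ∧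
        x = X.cnorm (X.d (k + 1) φ) / X.distToCoboundaries k φ} = ∅ := by
      refine Set.eq_empty_iff_forall_notMem.mpr ?_
      rintro x ⟨φ, hφ, -⟩
      exact h ⟨φ, hφ⟩
    rw [coboundaryExpansion, this, Real.sInf_empty]
    exact zero_le_one

/-! ### The walks on all links -/

/-- The bound on the one-dimensional links descends to all links of positive dimension. -/
theorem HasLocalSpectralExpansion.hasWalkBound_link {X : WeightedComplex V} {n : ℕ} {lam κ : ℝ}
    (hX : X.HasLocalSpectralExpansion n lam) (hκ : 0 ≤ κ) (hlam : 1 - κ / (1 + n * κ) ≤ lam)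
    {τ : Finset V} {t : ℕ} (ht : t + 2 ≤ n + 1) (hτ : τ ∈ X.cells t) :
    (X.link τ (mem_cells.mp hτ).1).HasWalkBound κ := by
  obtain ⟨hr, -, -, hc, hs⟩ := hX
  obtain ⟨hτ', hτc⟩ := mem_cells.mp hτ
  obtain ⟨k, hk⟩ : ∃ k, n + 1 = t + (k + 2) := ⟨n + 1 - t - 2, by omega⟩
  have hkn : (k : ℝ) ≤ n := by
    have : k ≤ n := by omega
    exact_mod_cast this
  have hpos : 0 < 1 + k * κ := by positivity
  -- the value `θ` of the gap for which `k` steps of the descent give exactly `κ`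
  have hθ : κ / (1 + k * κ) / (1 - k * (κ / (1 + k * κ))) = κ := by
    have : 1 - k * (κ / (1 + k * κ)) = 1 / (1 + k * κ) := by
      field_simp
      ring
    rw [this]
    field_simp
  rw [← hθ]
  refine hasWalkBound_of_rank k _ _ ?_ (by positivity) ?_ ?_ ?_
  · change X.rank - τ.card = _
    omega
  · rw [mul_div_assoc', div_lt_one hpos]
    linarith
  · intro σ hσ hrk
    have hu := (Finset.mem_filter.mp hσ).2.2
    rw [X.link_link _ hσ hu] at hrk ⊢
    exact hc _ hu hrk
  · intro σ hσ hrk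
    have hu := (Finset.mem_filter.mp hσ).2.2
    rw [X.link_link _ hσ hu] at hrk ⊢
    refine le_trans ?_ (hs _ hu hrk)
    refine le_trans ?_ hlam
    have : κ / (1 + n * κ) ≤ κ / (1 + k * κ) := by gcongr
    linarith

theorem cells_zero (X : WeightedComplex V) : X.cells 0 = {∅} := by
  ext σ
  rw [mem_cells, Finset.card_eq_zero, Finset.mem_singleton]
  constructor
  · tauto
  · rintro rfl
    exact ⟨X.empty_mem, rfl⟩

theorem totalWeight_zero (X : WeightedComplex V) : X.totalWeight 0 = X.weight ∅ := by
  rw [totalWeight, cells_zero, Finset.sum_singleton]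

/-- The expander mixing lemma for sets of vertices. -/
theorem pairMass_vertices_le (X : WeightedComplex V) {κ : ℝ} (hκ : 0 ≤ κ)
    (hW : ∀ τ (hτ : τ ∈ X.cells 0), (X.link τ (mem_cells.mp hτ).1).HasWalkBound κ)
    {A : Finset (Finset V)} (hA : A ⊆ X.cells 1) :
    X.pairMass A (X.cells 0) 2 ≤ X.mass A * (κ + X.mass A / X.weight ∅) := by
  have h := X.pairMass_singleton_le X.empty_mem_cells hκ (hW _ X.empty_mem_cells) hA
  rwa [degOn_empty, ← cells_zero] at h

/-- The bound on the differential that comes from the spectral gaps alone. -/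
theorem le_oddMass (X : WeightedComplex V) {t : ℕ} (hr : t + 1 < X.rank) {κ : ℝ} (hκ : 0 ≤ κ)
    (hW : ∀ τ (hτ : τ ∈ X.cells t), (X.link τ (mem_cells.mp hτ).1).HasWalkBound κ)
    {A : Finset (Finset V)} (hA : A ⊆ X.cells (t + 1)) {δ c : ℝ} (hδ : 0 ≤ δ)
    (hc : ∀ τ ∈ X.cells t, X.degOn A τ ≤ c * X.weight τ) :
    X.mass A - (κ + δ) * ((t + 1) * X.mass A) -
      (κ + c) * ∑ σ ∈ A, X.weight σ * countIn (X.fat A δ t) σ ≤ X.oddMass A (t + 2) := by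
  have h1 := X.mass_sub_pairMass_le hA hr
  have h2 := X.pairMass_fat_add_thin A A δ t (t + 2)
  have h3 := X.pairMass_thin_le hκ hW hA hδ
  have h4 := X.pairMass_fat_le hκ hW hA (δ := δ) hc
  linarith

/-- A set of vertices carrying about half of the weight, or less, has a nonzero differential. -/
theorem cnorm_d_vertices_pos (X : WeightedComplex V) (hr : 1 < X.rank) {κ ε' : ℝ} (hκ : 0 ≤ κ)
    (hW : ∀ τ (hτ : τ ∈ X.cells 0), (X.link τ (mem_cells.mp hτ).1).HasWalkBound κ)
    (hκε : κ + (1 + ε') / 2 < 1) {φ : X.Cochain 1} (h0 : φ ≠ 0)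
    (hφ : X.IsLocallyMinimal ε' 0 φ) : 0 < X.cnorm (X.d 1 φ) := by
  have h1 : X.cnorm φ ≤ (1 + ε') * X.totalWeight 1 / 2 := hφ
  have h2 := X.totalWeight_succ (r := 0) (by omega)
  have hM := weight_pos_of_mem_cells X.empty_mem_cells
  have hs := cnorm_pos h0
  rw [totalWeight_zero] at h2
  rw [cnorm_eq_mass] at h1 hs
  have h3 := X.mass_sub_pairMass_le (X.supp_subset φ) hr
  have h4 := X.pairMass_vertices_le hκ hW (X.supp_subset φ)
  rw [cnorm_d]
  have h5 : X.mass (X.supp φ) / X.weight ∅ ≤ (1 + ε') / 2 := by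
    rw [div_le_iff₀ hM, h2]
    push_cast
    linarith
  simp only [zero_add] at h3
  nlinarith

/-! ### One-cochains -/

theorem countIn_vertices_le (X : WeightedComplex V) {B : Finset (Finset V)} (hB : B ⊆ X.cells 1)
    {e : Finset V} (he : e ∈ X.cells 2) : countIn B e ≤ 1 + pairCount B (X.cells 0) e := by
  have h1 := X.countIn_sq_le (t := 0) hB he
  rcases Nat.lt_or_ge (countIn B e) 2 with h | h
  · omega
  · nlinarith

/-- The combination of the bounds for one-cochains: `s` is the norm of the cochain, `b` the weight
of the fat vertices, `P` the weight of the edges between them and `D` the norm of the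
differential. -/
theorem quarter_le_of_bounds {κ ε' C s b M w P K D : ℝ} (hκ : 0 ≤ κ) (hκ' : κ ≤ 1 / 10 ^ 6)
    (hε : 0 ≤ ε') (hε' : ε' ≤ 1 / 10 ^ 6) (hC : C ≤ 1 / 10 ^ 6) (hM : 0 < M) (hMw : M = 2 * w)
    (hs : 0 ≤ s) (hb : 0 ≤ b) (h1 : s - (κ + 1 / 100) * (2 * s) - (κ + (1 + ε') / 2) * K ≤ D)
    (h2 : K ≤ s + P) (h3 : P ≤ b * (κ + b / M)) (h4 : 1 / 100 * b ≤ 2 * s) (h5 : s ≤ C * w) :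
    1 / 4 * s ≤ D := by
  have h6 : C * w ≤ 1 / 10 ^ 6 * w := mul_le_mul_of_nonneg_right hC (by linarith)
  have h7 : b / M ≤ 1 / 10 ^ 4 := by
    rw [div_le_iff₀ hM]
    linarith
  have h8 : b * (κ + b / M) ≤ b * (1 / 10 ^ 6 + 1 / 10 ^ 4) :=
    mul_le_mul_of_nonneg_left (by linarith) hb
  have h9 : (κ + (1 + ε') / 2) * K ≤ (κ + (1 + ε') / 2) * (s + 3 / 100 * s) :=
    mul_le_mul_of_nonneg_left (by linarith) (by linarith)
  have h10 : (κ + (1 + ε') / 2) * (s + 3 / 100 * s) ≤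
      (1 / 10 ^ 6 + (1 + 1 / 10 ^ 6) / 2) * (s + 3 / 100 * s) :=
    mul_le_mul_of_nonneg_right (by linarith) (by linarith)
  have h11 : (κ + 1 / 100) * (2 * s) ≤ (1 / 10 ^ 6 + 1 / 100) * (2 * s) :=
    mul_le_mul_of_nonneg_right (by linarith) (by linarith)
  linarith

/-- There are few fat vertices, hence few edges between them, so that almost every edge of the
support has at most one fat vertex. -/
theorem cnorm_d_edges (X : WeightedComplex V) (hr : 2 < X.rank) {κ ε' C : ℝ} (hκ : 0 ≤ κ)
    (hκ' : κ ≤ 1 / 10 ^ 6) (hε : 0 ≤ ε') (hε' : ε' ≤ 1 / 10 ^ 6) (hC : C ≤ 1 / 10 ^ 6)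
    (hW : ∀ t ≤ 1, ∀ τ (hτ : τ ∈ X.cells t), (X.link τ (mem_cells.mp hτ).1).HasWalkBound κ)
    {φ : X.Cochain 2} (hφ : X.IsLocallyMinimal ε' 1 φ)
    (hsmall : X.cnorm φ ≤ C * X.totalWeight 2) : 1 / 4 * X.cnorm φ ≤ X.cnorm (X.d 2 φ) := by
  have hS := X.supp_subset φ
  set S := X.supp φ
  rw [cnorm_d, cnorm_eq_mass]
  rw [cnorm_eq_mass] at hsmall
  change X.mass S ≤ _ at hsmall
  change _ * X.mass S ≤ X.oddMass S 3
  set B := X.fat S (1 / 100) 1 with hBdef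
  have hB : B ⊆ X.cells 1 := X.fat_subset _ _ _
  have hM := weight_pos_of_mem_cells X.empty_mem_cells
  have hT : X.weight ∅ = 2 * X.totalWeight 2 := by
    have h1 := X.totalWeight_succ (r := 0) (by omega)
    have h2 := X.totalWeight_succ (r := 1) (by omega)
    rw [totalWeight_zero] at h1
    rw [h1, h2]
    push_cast
    ring
  have hs := mass_nonneg hS
  have hb := mass_nonneg hB
  have hdeg : ∀ τ ∈ X.cells 1, X.degOn S τ ≤ (1 + ε') / 2 * X.weight τ := fun τ hτ =>
    X.degOn_le_of_isLocallyMinimal (k := 0) (by omega) hφ hτ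
  have h1 := X.le_oddMass (t := 1) hr hκ (hW 1 le_rfl) hS (δ := 1 / 100) (by norm_num) hdeg
  have h2 : ∑ σ ∈ S, X.weight σ * countIn B σ ≤ X.mass S + X.pairMass B (X.cells 0) 2 := by
    calc _ ≤ ∑ σ ∈ S, (X.weight σ + X.weight σ * pairCount B (X.cells 0) σ) := by
          refine Finset.sum_le_sum fun σ hσ => ?_
          have hw := weight_pos_of_mem_cells (hS hσ)
          have h : (countIn B σ : ℝ) ≤ 1 + pairCount B (X.cells 0) σ := by
            exact_mod_cast X.countIn_vertices_le hB (hS hσ)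
          nlinarith
      _ ≤ _ := by
          rw [Finset.sum_add_distrib]
          refine add_le_add le_rfl (Finset.sum_le_sum_of_subset_of_nonneg hS fun σ hσ _ => ?_)
          have hw := weight_pos_of_mem_cells hσ
          positivity
  have h3 := X.pairMass_vertices_le hκ (hW 0 (by norm_num)) hB
  have h4 := X.mass_fat_le hS (1 / 100)
  rw [← hBdef] at h1 h4
  have e : ((1 : ℕ) : ℝ) + 1 = 2 := by norm_num
  rw [e] at h1 h4
  exact quarter_le_of_bounds hκ hκ' hε hε' hC hM hT hs hb h1 h2 h3 h4 hsmall

/-! ### Two-cochains: combinatorics of fat edges and fat vertices -/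

theorem one_le_pairCount {A B : Finset (Finset V)} {η σ σ' : Finset V} (h1 : σ ∈ A) (h2 : σ' ∈ A)
    (hu : σ ∪ σ' = η) (hi : σ ∩ σ' ∈ B) : 1 ≤ pairCount A B η :=
  Finset.card_pos.mpr
    ⟨(σ, σ'), Finset.mem_filter.mpr ⟨Finset.mem_product.mpr ⟨h1, h2⟩, hu, hi⟩⟩

theorem one_le_countIn {A : Finset (Finset V)} {η σ : Finset V} (h1 : σ ∈ A) (h2 : σ ⊆ η) :
    1 ≤ countIn A η :=
  Finset.card_pos.mpr ⟨σ, Finset.mem_filter.mpr ⟨h1, h2⟩⟩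

theorem one_le_sum_filter {ι : Type*} {s : Finset ι} {p : ι → Prop} [DecidablePred p] {f : ι → ℕ}
    {i : ι} (hi : i ∈ s) (hp : p i) (hf : 1 ≤ f i) : 1 ≤ ∑ j ∈ s with p j, f j :=
  hf.trans (Finset.single_le_sum (f := f) (fun _ _ => Nat.zero_le _)
    (Finset.mem_filter.mpr ⟨hi, hp⟩))

theorem exists_edge_of_two_le_countIn (X : WeightedComplex V) {B : Finset (Finset V)}
    (hB : B ⊆ X.cells 1) {η : Finset V} {r : ℕ} (hη : η ∈ X.cells r) (h : 2 ≤ countIn B η) :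
    ∃ e ∈ X.cells 2, e ⊆ η ∧ 1 ≤ pairCount B (X.cells 0) e := by
  obtain ⟨u, hu, v, hv, hne⟩ := Finset.one_lt_card.mp h
  rw [Finset.mem_filter] at hu hv
  have hsub := Finset.union_subset hu.2 hv.2
  have hu1 := (mem_cells.mp (hB hu.1)).2
  have hv1 := (mem_cells.mp (hB hv.1)).2
  have hd : Disjoint u v := by
    rw [Finset.card_eq_one] at hu1 hv1
    obtain ⟨a, rfl⟩ := hu1
    obtain ⟨b, rfl⟩ := hv1
    rw [Finset.disjoint_singleton]
    rintro rfl
    exact hne rfl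
  refine ⟨u ∪ v, mem_cells.mpr ⟨X.down_closed _ (mem_cells.mp hη).1 _ hsub, ?_⟩, hsub,
    one_le_pairCount hu.1 hv.1 rfl ?_⟩
  · rw [Finset.card_union_of_disjoint hd]
    omega
  · rw [Finset.disjoint_iff_inter_eq_empty.mp hd]
    exact X.empty_mem_cells

section Pointwise

variable (X : WeightedComplex V) {F B T : Finset (Finset V)}

theorem one_le_of_two_le_countIn (hF : F ⊆ X.cells 2) (hBT : ∀ x ∈ X.cells 1, x ∈ B ∨ x ∈ T)
    {t : Finset V} (ht : t ∈ X.cells 3) (h : 2 ≤ countIn F t) :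
    1 ≤ countIn B t + pairCount F T t := by
  obtain ⟨e, he, e', he', hne⟩ := Finset.one_lt_card.mp h
  rw [Finset.mem_filter] at he he'
  obtain ⟨hu, hi⟩ := pair_of_ne ht (hF he.1) (hF he'.1) he.2 he'.2 hne
  rcases hBT _ hi with h1 | h1
  · have := one_le_countIn h1 (inter_subset_left.trans he.2)
    omega
  · have := one_le_pairCount he.1 he'.1 hu h1
    omega

/-- If all edges of a triangle are in `F`, then two of them meet in a vertex of `T` or two of the
vertices are in `B`. -/
theorem one_le_of_three_le_countIn (hF : F ⊆ X.cells 2) (hB : B ⊆ X.cells 1)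
    (hBT : ∀ x ∈ X.cells 1, x ∈ B ∨ x ∈ T) {t : Finset V} (ht : t ∈ X.cells 3)
    (h : 3 ≤ countIn F t) :
    1 ≤ pairCount F T t + ∑ e ∈ X.cells 2 with e ⊆ t, pairCount B (X.cells 0) e := by
  obtain ⟨e₁, h₁, e₂, h₂, e₃, h₃, h₁₂, h₁₃, h₂₃⟩ := Finset.two_lt_card.mp h
  rw [Finset.mem_filter] at h₁ h₂ h₃
  obtain ⟨hu, hi⟩ := pair_of_ne ht (hF h₁.1) (hF h₂.1) h₁.2 h₂.2 h₁₂
  obtain ⟨hu', hi'⟩ := pair_of_ne ht (hF h₁.1) (hF h₃.1) h₁.2 h₃.2 h₁₃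
  rcases hBT _ hi with hx | hx
  · rcases hBT _ hi' with hx' | hx'
    · have hne : e₁ ∩ e₂ ≠ e₁ ∩ e₃ := by
        intro heq
        have hsub : e₃ ⊆ e₂ := by
          intro a ha
          rcases Finset.mem_union.mp (hu ▸ h₃.2 ha) with h4 | h4
          · exact Finset.mem_of_mem_inter_right (heq ▸ Finset.mem_inter.mpr ⟨h4, ha⟩)
          · exact h4
        have c2 := (mem_cells.mp (hF h₂.1)).2
        have c3 := (mem_cells.mp (hF h₃.1)).2
        exact h₂₃ (Finset.eq_of_subset_of_card_le hsub (by omega)).symm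
      have h2 : 2 ≤ countIn B t := Finset.one_lt_card.mpr
        ⟨_, Finset.mem_filter.mpr ⟨hx, inter_subset_left.trans h₁.2⟩,
          _, Finset.mem_filter.mpr ⟨hx', inter_subset_left.trans h₁.2⟩, hne⟩
      obtain ⟨e, he, hsub, hp⟩ := X.exists_edge_of_two_le_countIn hB ht h2
      exact (one_le_sum_filter he hsub hp).trans (Nat.le_add_left _ _)
    · exact (one_le_pairCount h₁.1 h₃.1 hu' hx').trans (Nat.le_add_right _ _)
  · exact (one_le_pairCount h₁.1 h₂.1 hu hx).trans (Nat.le_add_right _ _)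

/-- Let `v` be a vertex in `B` of a tetrahedron `η` that lies in an odd number of triangles of `S`.
If the total number of triangles of `S` in `η` is even, then the triangle `t` opposite to `v` is
in `S`; it meets a triangle `t' ∋ v` of `S` in an edge `e`. Either `e` is in `T₁`, or `e` is the
only edge of `t'` in `F`, or `t'` has two edges in `F` that meet in a vertex of `e`, which is in `T`
unless `η` has two vertices in `B`. -/
theorem card_odd_vertices_le {S T₁ : Finset (Finset V)} (hS : S ⊆ X.cells 3) (hF : F ⊆ X.cells 2)
    (hB : B ⊆ X.cells 1) (hBT : ∀ x ∈ X.cells 1, x ∈ B ∨ x ∈ T)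
    (hFT : ∀ e ∈ X.cells 2, e ∈ F ∨ e ∈ T₁) {η : Finset V} (hη : η ∈ X.cells 4) :
    #{v ∈ B | v ⊆ η ∧ Odd (countIn {σ ∈ S | v ⊆ σ} η)} ≤
      (if Odd (countIn S η) then 1 else 0) +
      countIn {t ∈ S | countIn F t ≤ 1 ∧ 1 ≤ countIn B t} η +
      4 * (∑ t ∈ X.cells 3 with t ⊆ η, ∑ e ∈ X.cells 2 with e ⊆ t, pairCount B (X.cells 0) e) +
      pairCount S T₁ η + ∑ t ∈ X.cells 3 with t ⊆ η, pairCount F T t := by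
  have hle : #{v ∈ B | v ⊆ η ∧ Odd (countIn {σ ∈ S | v ⊆ σ} η)} ≤ countIn B η :=
    Finset.card_le_card fun v hv => by
      rw [Finset.mem_filter] at hv ⊢
      exact ⟨hv.1, hv.2.1⟩
  have hηc := (mem_cells.mp hη).2
  rcases Nat.lt_or_ge (countIn B η) 2 with hB1 | hB2
  · rcases Finset.eq_empty_or_nonempty {v ∈ B | v ⊆ η ∧ Odd (countIn {σ ∈ S | v ⊆ σ} η)} with
      h0 | ⟨v, hv⟩
    · rw [h0, Finset.card_empty]
      exact Nat.zero_le _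
    · rw [Finset.mem_filter] at hv
      obtain ⟨hvB, hvη, hodd⟩ := hv
      by_cases hSodd : Odd (countIn S η)
      · rw [if_pos hSodd]
        omega
      have hsplit : countIn S η = countIn {σ ∈ S | v ⊆ σ} η + countIn {σ ∈ S | ¬ v ⊆ σ} η := by
        simp only [countIn, Finset.filter_filter]
        rw [← Finset.card_filter_add_card_filter_not (s := {σ ∈ S | σ ⊆ η}) (fun σ => v ⊆ σ)]
        simp only [Finset.filter_filter, and_comm]
      have hpos : 0 < countIn {σ ∈ S | ¬ v ⊆ σ} η := by
        by_contra h0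
        have h0 : countIn {σ ∈ S | ¬ v ⊆ σ} η = 0 := by omega
        rw [hsplit, h0, add_zero] at hSodd
        exact hSodd hodd
      obtain ⟨t, ht⟩ := Finset.card_pos.mp hpos
      obtain ⟨t', ht'⟩ := Finset.card_pos.mp hodd.pos
      simp only [Finset.mem_filter] at ht ht'
      obtain ⟨⟨htS, hvt⟩, htη⟩ := ht
      obtain ⟨⟨htS', hvt'⟩, htη'⟩ := ht'
      have hne : t ≠ t' := by
        rintro rfl
        exact hvt hvt'
      obtain ⟨hu, hi⟩ := pair_of_ne hη (hS htS) (hS htS') htη htη' hne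
      rcases hFT _ hi with he | he
      · rcases Nat.lt_or_ge 1 (countIn F t') with hF2 | hF1
        · obtain ⟨e', he', hne'⟩ := Finset.exists_mem_ne hF2 (t ∩ t')
          rw [Finset.mem_filter] at he'
          obtain ⟨hu2, hi2⟩ := pair_of_ne (hS htS') (hF he'.1) hi he'.2 inter_subset_right hne'
          have hxt : e' ∩ (t ∩ t') ⊆ t := inter_subset_right.trans inter_subset_left
          rcases hBT _ hi2 with hx | hx
          · exfalso
            have : 2 ≤ countIn B η := Finset.one_lt_card.mpr
              ⟨_, Finset.mem_filter.mpr ⟨hx, hxt.trans htη⟩,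
                v, Finset.mem_filter.mpr ⟨hvB, hvη⟩, fun h => hvt (h ▸ hxt)⟩
            omega
          · have h1 := one_le_pairCount he'.1 he hu2 hx
            have h2 := one_le_sum_filter (p := fun t => t ⊆ η) (f := pairCount F T) (hS htS')
              htη' h1
            omega
        · have h1 : 1 ≤ countIn {t ∈ S | countIn F t ≤ 1 ∧ 1 ≤ countIn B t} η :=
            one_le_countIn (Finset.mem_filter.mpr ⟨htS', hF1, one_le_countIn hvB hvt'⟩) htη'
          omega
      · have h1 := one_le_pairCount htS htS' hu he
        omega
  · have h4 : countIn B η ≤ 4 := by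
      calc countIn B η ≤ #(η.powersetCard 1) := by
            refine Finset.card_le_card fun v hv => ?_
            rw [Finset.mem_filter] at hv
            exact Finset.mem_powersetCard.mpr ⟨hv.2, (mem_cells.mp (hB hv.1)).2⟩
        _ = 4 := by rw [Finset.card_powersetCard, hηc, Nat.choose_one_right]
    obtain ⟨e, he, heη, hp⟩ := X.exists_edge_of_two_le_countIn hB hη hB2
    obtain ⟨t, het, htη, htc⟩ := Finset.exists_subsuperset_card_eq heη
      (n := 3) (by rw [(mem_cells.mp he).2]; norm_num) (by rw [hηc]; norm_num)
    have ht : t ∈ X.cells 3 := mem_cells.mpr ⟨X.down_closed _ (mem_cells.mp hη).1 _ htη, htc⟩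
    have h1 := one_le_sum_filter (p := fun t => t ⊆ η)
      (f := fun t => ∑ e ∈ X.cells 2 with e ⊆ t, pairCount B (X.cells 0) e) ht htη
      (one_le_sum_filter (p := fun e => e ⊆ t) (f := pairCount B (X.cells 0)) he het hp)
    omega

end Pointwise

/-! ### Two-cochains: the bound from coboundary expansion -/

theorem pairMass_vertices_eq_sum_triangles (X : WeightedComplex V) (hr : 2 < X.rank)
    (B : Finset (Finset V)) :
    X.pairMass B (X.cells 0) 2 = ∑ t ∈ X.cells 3, X.weight t *
      (∑ e ∈ X.cells 2 with e ⊆ t, pairCount B (X.cells 0) e : ℕ) := by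
  rw [pairMass, X.sum_weight_mul (Finset.Subset.refl _) hr]
  push_cast
  rfl

theorem sum_tetrahedra (X : WeightedComplex V) (hr : 3 < X.rank) (g : Finset V → ℕ) :
    ∑ t ∈ X.cells 3, X.weight t * (g t : ℝ) =
      ∑ η ∈ X.cells 4, X.weight η * (∑ t ∈ X.cells 3 with t ⊆ η, g t : ℕ) := by
  rw [X.sum_weight_mul (Finset.Subset.refl _) hr]
  push_cast
  rfl

/-- The expansion of the links of the vertices in `B`, summed over `B`. -/
theorem expansion_le_sum_links (X : WeightedComplex V) {ε ε' : ℝ} (hε : 0 < ε)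
    (hX : ∀ (v : Finset V) (hv : v ∈ X.cells 1),
      ε ≤ (X.link v (mem_cells.mp hv).1).coboundaryExpansion 1)
    {φ : X.Cochain 3} (hφ : X.IsLocallyMinimal ε' 2 φ) {B : Finset (Finset V)}
    (hB : B ⊆ X.cells 1) :
    ε * (∑ t ∈ X.supp φ, X.weight t * countIn B t - ε' * X.mass B) ≤
      ∑ η ∈ X.cells 4, X.weight η *
        (#{v ∈ B | v ⊆ η ∧ Odd (countIn {σ ∈ X.supp φ | v ⊆ σ} η)} : ℕ) := by
  calc ε * (∑ t ∈ X.supp φ, X.weight t * countIn B t - ε' * X.mass B)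
      = ∑ v ∈ B, ε * (X.degOn (X.supp φ) v - ε' * X.weight v) := by
        rw [← sum_degOn, ← Finset.mul_sum, Finset.sum_sub_distrib, ← Finset.mul_sum, mass]
    _ ≤ ∑ v ∈ B, ∑ η ∈ X.cells 4,
          if v ⊆ η ∧ Odd (countIn {σ ∈ X.supp φ | v ⊆ σ} η) then X.weight η else 0 := by
        refine Finset.sum_le_sum fun v hv => ?_
        have hv := hB hv
        rw [← X.cnorm_localize (t := 1) (s := 2) rfl φ hv,
          ← X.cnorm_d_localize (t := 1) (s := 2) rfl φ hv]
        exact expansion_le_cnorm_d _ hε (hX v hv) fun ψ hψ => hφ 0 1 rfl v hv ψ hψ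
    _ = _ := by
        rw [Finset.sum_comm]
        refine Finset.sum_congr rfl fun η _ => ?_
        rw [← Finset.sum_filter, Finset.sum_const, nsmul_eq_mul, mul_comm]

section Estimates

variable (X : WeightedComplex V) {S F B T T₁ : Finset (Finset V)}

theorem sum_mul_pairCount_le (hS : S ⊆ X.cells 3) (F T : Finset (Finset V)) :
    ∑ t ∈ S, X.weight t * (pairCount F T t : ℝ) ≤ X.pairMass F T 3 :=
  Finset.sum_le_sum_of_subset_of_nonneg hS fun _ ht _ =>
    mul_nonneg (weight_pos_of_mem_cells ht).le (Nat.cast_nonneg _)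

theorem mass_filter_eq (S : Finset (Finset V)) (p : Finset V → Prop) [DecidablePred p] :
    X.mass {t ∈ S | p t} = ∑ t ∈ S, X.weight t * ((if p t then 1 else 0 : ℕ) : ℝ) := by
  rw [mass, Finset.sum_filter]
  refine Finset.sum_congr rfl fun t _ => ?_
  split_ifs <;> simp

theorem sum_countIn_edges_le (hS : S ⊆ X.cells 3) (hF : F ⊆ X.cells 2) :
    ∑ t ∈ S, X.weight t * countIn F t ≤ X.mass S + X.mass {t ∈ S | 2 ≤ countIn F t} +
      X.mass {t ∈ S | 3 ≤ countIn F t} := by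
  rw [mass_filter_eq, mass_filter_eq, mass, ← Finset.sum_add_distrib, ← Finset.sum_add_distrib]
  refine Finset.sum_le_sum fun t ht => ?_
  have hw := weight_pos_of_mem_cells (hS ht)
  have h3 : countIn F t ≤ 3 := countIn_le hF (mem_cells.mp (hS ht)).2
  have h : countIn F t ≤ 1 + (if 2 ≤ countIn F t then 1 else 0) +
      (if 3 ≤ countIn F t then 1 else 0) := by
    split_ifs <;> omega
  have h' : (countIn F t : ℝ) ≤ 1 + ((if 2 ≤ countIn F t then 1 else 0 : ℕ) : ℝ) +
      ((if 3 ≤ countIn F t then 1 else 0 : ℕ) : ℝ) := by exact_mod_cast h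
  calc X.weight t * countIn F t ≤ X.weight t * _ := mul_le_mul_of_nonneg_left h' hw.le
    _ = _ := by ring

theorem mass_three_le (hr : 2 < X.rank) (hS : S ⊆ X.cells 3) (hF : F ⊆ X.cells 2)
    (hB : B ⊆ X.cells 1) (hBT : ∀ x ∈ X.cells 1, x ∈ B ∨ x ∈ T) :
    X.mass {t ∈ S | 3 ≤ countIn F t} ≤ X.pairMass F T 3 + X.pairMass B (X.cells 0) 2 := by
  rw [mass_filter_eq, pairMass_vertices_eq_sum_triangles X hr, pairMass, ← Finset.sum_add_distrib]
  refine le_trans (Finset.sum_le_sum fun t ht => ?_)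
    (Finset.sum_le_sum_of_subset_of_nonneg hS fun _ ht _ => ?_)
  · have hw := weight_pos_of_mem_cells (hS ht)
    rw [← mul_add]
    refine mul_le_mul_of_nonneg_left ?_ hw.le
    norm_cast
    split_ifs with h
    · exact X.one_le_of_three_le_countIn hF hB hBT (hS ht) h
    · exact Nat.zero_le _
  · have hw := weight_pos_of_mem_cells ht
    positivity

/-- A triangle with two edges in `F` has a vertex in `B`, or these edges meet in a vertex
of `T`. -/
theorem mass_two_add_mass_le (hS : S ⊆ X.cells 3) (hF : F ⊆ X.cells 2)
    (hBT : ∀ x ∈ X.cells 1, x ∈ B ∨ x ∈ T) :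
    X.mass {t ∈ S | 2 ≤ countIn F t} + X.mass {t ∈ S | countIn F t ≤ 1 ∧ 1 ≤ countIn B t} ≤
      ∑ t ∈ S, X.weight t * countIn B t + X.pairMass F T 3 := by
  refine le_trans ?_ (add_le_add le_rfl (X.sum_mul_pairCount_le hS F T))
  rw [mass_filter_eq, mass_filter_eq, ← Finset.sum_add_distrib, ← Finset.sum_add_distrib]
  refine Finset.sum_le_sum fun t ht => ?_
  have hw := weight_pos_of_mem_cells (hS ht)
  rw [← mul_add, ← mul_add]
  refine mul_le_mul_of_nonneg_left ?_ hw.le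
  norm_cast
  have h1 := X.one_le_of_two_le_countIn hF hBT (hS ht)
  split_ifs <;> omega

theorem mass_add_mass_two_le (hS : S ⊆ X.cells 3) (F B : Finset (Finset V)) :
    X.mass {t ∈ S | countIn F t ≤ 1 ∧ 1 ≤ countIn B t} + X.mass {t ∈ S | 2 ≤ countIn F t} ≤
      X.mass S := by
  rw [mass_filter_eq, mass_filter_eq, mass, ← Finset.sum_add_distrib]
  refine Finset.sum_le_sum fun t ht => ?_
  have hw := weight_pos_of_mem_cells (hS ht)
  rw [← mul_add]
  refine mul_le_of_le_one_right hw.le ?_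
  norm_cast
  split_ifs <;> omega

/-- The vertices of `B` whose localized differentials are nonzero on a tetrahedron, summed over all
tetrahedra. -/
theorem sum_odd_vertices_le (hr : 3 < X.rank) (hS : S ⊆ X.cells 3) (hF : F ⊆ X.cells 2)
    (hB : B ⊆ X.cells 1) (hBT : ∀ x ∈ X.cells 1, x ∈ B ∨ x ∈ T)
    (hFT : ∀ e ∈ X.cells 2, e ∈ F ∨ e ∈ T₁) :
    ∑ η ∈ X.cells 4, X.weight η * (#{v ∈ B | v ⊆ η ∧ Odd (countIn {σ ∈ S | v ⊆ σ} η)} : ℕ) ≤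
      X.oddMass S 4 + X.mass {t ∈ S | countIn F t ≤ 1 ∧ 1 ≤ countIn B t} +
      4 * X.pairMass B (X.cells 0) 2 + X.pairMass S T₁ 4 + X.pairMass F T 3 := by
  have hP : {t ∈ S | countIn F t ≤ 1 ∧ 1 ≤ countIn B t} ⊆ X.cells 3 :=
    (Finset.filter_subset _ _).trans hS
  have hFT3 : X.pairMass F T 3 =
      ∑ η ∈ X.cells 4, X.weight η * (∑ t ∈ X.cells 3 with t ⊆ η, pairCount F T t : ℕ) :=
    X.sum_tetrahedra hr _
  rw [oddMass, X.mass_eq_sum_countIn hP hr, X.pairMass_vertices_eq_sum_triangles (by omega),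
    X.sum_tetrahedra hr, hFT3, pairMass, Finset.mul_sum, ← Finset.sum_add_distrib,
    ← Finset.sum_add_distrib, ← Finset.sum_add_distrib, ← Finset.sum_add_distrib]
  refine Finset.sum_le_sum fun η hη => ?_
  have hw := weight_pos_of_mem_cells hη
  have h := X.card_odd_vertices_le hS hF hB hBT hFT hη
  have h' := mul_le_mul_of_nonneg_left (Nat.cast_le (α := ℝ).mpr h) hw.le
  refine h'.trans (le_of_eq ?_)
  have h4 : (if Odd (countIn S η) then X.weight η else 0) =
      X.weight η * ((if Odd (countIn S η) then 1 else 0 : ℕ) : ℝ) := by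
    split_ifs <;> simp
  rw [h4, Nat.cast_add, Nat.cast_add, Nat.cast_add, Nat.cast_add, Nat.cast_mul]
  push_cast
  ring

end Estimates

/-- The combination of the two bounds for a two-cochain of norm `s` with differential of norm `D`:
`a` and `p` are the weights of the triangles of the support with at least two fat edges, and with at
most one fat edge and a fat vertex; `f₁`, `f₀` are the weights of the fat edges and vertices, and
`z`, `Z₀`, `Z₁`, `Z₂` are error terms. The thresholds for fatness are `μ` for edges and `μ²` for
vertices. Up to errors of order `μ s`, the first says
`2 D ≥ s - a` and the second `D ≥ ε a - (1 - ε) (s - a)`, so that `3 D ≥ ε s`. -/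
theorem three_tenths_le_of_bounds {ε μ s a p z D K M w f₀ f₁ Z₀ Z₁ Z₂ N : ℝ} (hε : 0 < ε)
    (hε1 : ε ≤ 1) (hμ : μ = ε / 2000) (hM : 0 < M) (hMw : M = 6 * w) (hs : 0 ≤ s) (ha : 0 ≤ a)
    (hp : 0 ≤ p) (hf₀ : 0 ≤ f₀) (hsmall : s ≤ μ ^ 7 * w)
    (h1 : s - (μ ^ 4 + μ) * (3 * s) - (μ ^ 4 + (1 + μ ^ 4) / 2) * K ≤ D) (h2 : K ≤ s + a + z)
    (h3 : z ≤ Z₁ + Z₀) (h4 : p + a ≤ s) (h5 : a + p ≤ N + Z₁)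
    (h6 : ε * (N - μ ^ 4 * f₀) ≤ D + p + 4 * Z₀ + Z₂ + Z₁)
    (hZ₂ : Z₂ ≤ (μ ^ 4 + μ) * (3 * s)) (hZ₁' : Z₁ ≤ (μ ^ 4 + μ ^ 2) * (2 * f₁))
    (hf₁ : μ * f₁ ≤ 3 * s) (hf₀' : μ ^ 2 * f₀ ≤ 2 * f₁) (hZ₀ : Z₀ ≤ f₀ * (μ ^ 4 + f₀ / M)) :
    3 * ε / 10 * s ≤ D := by
  have hμ0 : 0 < μ := by rw [hμ]; positivity
  have hμ1 : μ ≤ 1 / 2000 := by rw [hμ]; linarith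
  have hμ3 : μ ^ 3 ≤ 1 / 2000 := by
    calc μ ^ 3 ≤ μ ^ 1 := pow_le_pow_of_le_one hμ0.le (by linarith) (by norm_num)
      _ ≤ _ := by rwa [pow_one]
  have hμ4 : μ ^ 4 ≤ 1 / 2000 * μ := by
    calc μ ^ 4 = μ ^ 3 * μ := by ring
      _ ≤ _ := mul_le_mul_of_nonneg_right hμ3 hμ0.le
  have hf₁0 : 0 ≤ f₁ := by nlinarith [sq_nonneg μ]
  have hμs : 0 ≤ μ * s := mul_nonneg hμ0.le hs
  have hff : μ ^ 3 * f₀ ≤ 6 * s := by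
    calc μ ^ 3 * f₀ = μ * (μ ^ 2 * f₀) := by ring
      _ ≤ μ * (2 * f₁) := mul_le_mul_of_nonneg_left hf₀' hμ0.le
      _ ≤ _ := by linarith
  have hμf : μ ^ 4 * f₀ ≤ 6 * (μ * s) := by
    calc μ ^ 4 * f₀ = μ * (μ ^ 3 * f₀) := by ring
      _ ≤ μ * (6 * s) := mul_le_mul_of_nonneg_left hff hμ0.le
      _ = _ := by ring
  have hfM : f₀ / M ≤ μ ^ 4 := by
    rw [div_le_iff₀ hM]
    have : μ ^ 3 * f₀ ≤ μ ^ 3 * (μ ^ 4 * M) := by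
      calc μ ^ 3 * f₀ ≤ 6 * (μ ^ 7 * w) := by linarith
        _ = _ := by rw [hMw]; ring
    exact le_of_mul_le_mul_left this (by positivity)
  have hZ₀'' : Z₀ ≤ 12 * (μ * s) := by
    have : f₀ * (μ ^ 4 + f₀ / M) ≤ f₀ * (μ ^ 4 + μ ^ 4) :=
      mul_le_mul_of_nonneg_left (by linarith) hf₀
    linarith
  have hZ₁'' : Z₁ ≤ 12 * (μ * s) := by
    have e1 : (μ ^ 4 + μ ^ 2) * (2 * f₁) ≤ (μ ^ 2 + μ ^ 2) * (2 * f₁) := by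
      refine mul_le_mul_of_nonneg_right ?_ (by linarith)
      have : μ ^ 4 ≤ μ ^ 2 := pow_le_pow_of_le_one hμ0.le (by linarith) (by norm_num)
      linarith
    have e2 : (μ ^ 2 + μ ^ 2) * (2 * f₁) = 4 * (μ * (μ * f₁)) := by ring
    have e3 : μ * (μ * f₁) ≤ μ * (3 * s) := mul_le_mul_of_nonneg_left hf₁ hμ0.le
    linarith
  have hss : (μ ^ 4 + μ) * (3 * s) ≤ 4 * (μ * s) := by
    have : (μ ^ 4 + μ) * (3 * s) ≤ (1 / 2000 * μ + μ) * (3 * s) :=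
      mul_le_mul_of_nonneg_right (by linarith) (by linarith)
    linarith
  have hK : (μ ^ 4 + (1 + μ ^ 4) / 2) * K ≤ (s + a) / 2 + 30 * (μ * s) := by
    have e1 : (μ ^ 4 + (1 + μ ^ 4) / 2) * K ≤
        (μ ^ 4 + (1 + μ ^ 4) / 2) * (s + a + 24 * (μ * s)) :=
      mul_le_mul_of_nonneg_left (by linarith) (by positivity)
    have e2 : μ ^ 4 * (s + a + 24 * (μ * s)) ≤ 1 / 2000 * μ * (s + a + 24 * (μ * s)) :=
      mul_le_mul_of_nonneg_right hμ4 (by linarith)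
    have e3 : μ * (s + a + 24 * (μ * s)) ≤ μ * (26 * s) := by
      refine mul_le_mul_of_nonneg_left ?_ hμ0.le
      have : μ * s ≤ 1 * s := mul_le_mul_of_nonneg_right (by linarith) hs
      linarith
    linarith
  have h7 : ε * (a + p - 18 * (μ * s)) ≤ D + p + 64 * (μ * s) := by
    have : ε * (a + p - 18 * (μ * s)) ≤ ε * (N - μ ^ 4 * f₀) :=
      mul_le_mul_of_nonneg_left (by linarith) hε.le
    linarith
  have h8 : ε * (18 * (μ * s)) ≤ 1 * (18 * (μ * s)) :=
    mul_le_mul_of_nonneg_right hε1 (by linarith)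
  have h9 : (1 - ε) * p ≤ (1 - ε) * (s - a) :=
    mul_le_mul_of_nonneg_left (by linarith) (by linarith)
  have h10 : μ * s = ε * s / 2000 := by rw [hμ]; ring
  have hεs : 0 ≤ ε * s := mul_nonneg hε.le hs
  nlinarith

/-- The bound for two-cochains. The two lower bounds for `‖dφ‖` complement each other: the spectral
one is good when few triangles have two fat edges, and the one from the coboundary expansion of the
links of the fat vertices is good when many do. -/
theorem cnorm_d_triangles (X : WeightedComplex V) (hr : 3 < X.rank) {ε μ : ℝ} (hε : 0 < ε)
    (hε1 : ε ≤ 1) (hμ : μ = ε / 2000)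
    (hW : ∀ t ≤ 2, ∀ τ (hτ : τ ∈ X.cells t),
      (X.link τ (mem_cells.mp hτ).1).HasWalkBound (μ ^ 4))
    (hX : ∀ (v : Finset V) (hv : v ∈ X.cells 1),
      ε ≤ (X.link v (mem_cells.mp hv).1).coboundaryExpansion 1)
    {φ : X.Cochain 3} (hφ : X.IsLocallyMinimal (μ ^ 4) 2 φ)
    (hsmall : X.cnorm φ ≤ μ ^ 7 * X.totalWeight 3) :
    3 * ε / 10 * X.cnorm φ ≤ X.cnorm (X.d 3 φ) := by
  have hμ0 : 0 < μ := by rw [hμ]; positivity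
  have hκ : 0 ≤ μ ^ 4 := by positivity
  have hM := weight_pos_of_mem_cells X.empty_mem_cells
  have hMw : X.weight ∅ = 6 * X.totalWeight 3 := by
    have h1 := X.totalWeight_succ (r := 0) (by omega)
    have h2 := X.totalWeight_succ (r := 1) (by omega)
    have h3 := X.totalWeight_succ (r := 2) (by omega)
    rw [totalWeight_zero] at h1
    rw [h1, h2, h3]
    push_cast
    ring
  have hexp := fun B hB => X.expansion_le_sum_links hε hX hφ (B := B) hB
  have hdeg : ∀ τ ∈ X.cells 2, X.degOn (X.supp φ) τ ≤ (1 + μ ^ 4) / 2 * X.weight τ := fun τ hτ =>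
    X.degOn_le_of_isLocallyMinimal (k := 1) (by omega) hφ hτ
  have hS := X.supp_subset φ
  rw [cnorm_eq_mass] at hsmall ⊢
  rw [cnorm_d]
  generalize X.supp φ = S at *
  set F := X.fat S μ 2 with hFdef
  have hF : F ⊆ X.cells 2 := X.fat_subset _ _ _
  set B := X.fat F (μ ^ 2) 1 with hBdef
  have hB : B ⊆ X.cells 1 := X.fat_subset _ _ _
  have hBT : ∀ x ∈ X.cells 1, x ∈ B ∨ x ∈ X.thin F (μ ^ 2) 1 := by
    intro x hx
    simp only [hBdef, fat, thin, Finset.mem_filter, hx, true_and]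
    exact em _
  have hFT : ∀ x ∈ X.cells 2, x ∈ F ∨ x ∈ X.thin S μ 2 := by
    intro x hx
    simp only [hFdef, fat, thin, Finset.mem_filter, hx, true_and]
    exact em _
  have e2 : ((2 : ℕ) : ℝ) + 1 = 3 := by norm_num
  have e1 : ((1 : ℕ) : ℝ) + 1 = 2 := by norm_num
  have h1 := X.le_oddMass (t := 2) hr hκ (hW 2 le_rfl) hS hμ0.le hdeg
  have hZ₂ := X.pairMass_thin_le hκ (hW 2 le_rfl) hS hμ0.le
  have hZ₁ := X.pairMass_thin_le hκ (hW 1 (by norm_num)) hF (sq_nonneg μ)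
  have hf₁ := X.mass_fat_le hS μ
  have hf₀ := X.mass_fat_le hF (μ ^ 2)
  rw [e2] at h1 hZ₂ hf₁
  rw [e1] at hZ₁ hf₀
  exact three_tenths_le_of_bounds hε hε1 hμ hM hMw (mass_nonneg hS)
    (mass_nonneg ((Finset.filter_subset _ _).trans hS))
    (mass_nonneg ((Finset.filter_subset _ _).trans hS)) (mass_nonneg hB) hsmall h1
    (X.sum_countIn_edges_le hS hF)
    (X.mass_three_le (by omega) hS hF hB hBT) (X.mass_add_mass_two_le hS F B)
    (X.mass_two_add_mass_le hS hF hBT)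
    ((hexp B hB).trans (X.sum_odd_vertices_le hr hS hF hB hBT hFT)) hZ₂ hZ₁ hf₁ hf₀
    (X.pairMass_vertices_le hκ (hW 0 (by norm_num)) hB)

end WeightedComplex

/-! ### The isoperimetric inequalities -/

open WeightedComplex in
theorem theorem7p11 (n : ℕ) (hn : 2 < n) (ε : ℝ) (hε : 0 < ε) :
    ∃ Λ₂ ε' C₁ C₂ : ℝ, ((n : ℝ) - 1) / n < Λ₂ ∧ Λ₂ < 1 ∧ 0 < ε' ∧ 0 < C₁ ∧ 0 < C₂ ∧
      ∀ (V : Type*) [DecidableEq V] (X : WeightedComplex V) (lam : ℝ),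
        X.HasLocalSpectralExpansion n lam → Λ₂ ≤ lam →
        (∀ (v : Finset V) (hv : v ∈ X.cells 1),
          ε ≤ (X.link v (WeightedComplex.mem_cells.mp hv).1).coboundaryExpansion 1) →
        (∀ φ : X.Cochain 1, φ ≠ 0 → X.IsLocallyMinimal ε' 0 φ → 0 < X.cnorm (X.d 1 φ)) ∧
        (∀ φ : X.Cochain 2, φ ≠ 0 → X.IsLocallyMinimal ε' 1 φ →
          X.cnorm φ ≤ C₁ * X.totalWeight 2 →
          1 / 4 * X.cnorm φ ≤ X.cnorm (X.d 2 φ) ∧ 0 < 1 / 4 * X.cnorm φ) ∧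
        (∀ φ : X.Cochain 3, φ ≠ 0 → X.IsLocallyMinimal ε' 2 φ →
          X.cnorm φ ≤ C₂ * X.totalWeight 3 →
          3 * ε / 10 * X.cnorm φ ≤ X.cnorm (X.d 3 φ) ∧ 0 < 3 * ε / 10 * X.cnorm φ) := by
  -- the minimum is `ε` as soon as `X` has a vertex, since no coboundary expansion exceeds `1`
  obtain ⟨μ, hμ⟩ : ∃ μ, μ = min ε 1 / 2000 := ⟨_, rfl⟩
  have hμ0 : 0 < μ := by
    rw [hμ]
    have := lt_min hε one_pos
    positivity
  have hμ1 : μ ≤ 1 / 2000 := by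
    rw [hμ]
    linarith [min_le_right ε 1]
  have hμ4 : μ ^ 4 ≤ 1 / 10 ^ 6 := by
    calc μ ^ 4 ≤ (1 / 2000) ^ 4 := pow_le_pow_left₀ hμ0.le hμ1 4
      _ ≤ _ := by norm_num
  have hμ7 : μ ^ 7 ≤ 1 / 10 ^ 6 := by
    calc μ ^ 7 ≤ (1 / 2000) ^ 7 := pow_le_pow_left₀ hμ0.le hμ1 7
      _ ≤ _ := by norm_num
  have hκ : 0 < μ ^ 4 := by positivity
  have hn0 : (0 : ℝ) < n := by
    have : 0 < n := by omega
    exact_mod_cast this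
  refine ⟨1 - μ ^ 4 / (1 + n * μ ^ 4), μ ^ 4, μ ^ 7, μ ^ 7, ?_, ?_, hκ, by positivity,
    by positivity, ?_⟩
  · have h1 : ((n : ℝ) - 1) / n = 1 - 1 / n := by field_simp
    rw [h1, sub_lt_sub_iff_left, div_lt_div_iff₀ (by positivity) hn0]
    linarith
  · have : 0 < μ ^ 4 / (1 + n * μ ^ 4) := by positivity
    linarith
  intro V _ X lam hX hlam hexp
  have hr := hX.1
  have hW : ∀ t ≤ 2, ∀ τ (hτ : τ ∈ X.cells t),
      (X.link τ (mem_cells.mp hτ).1).HasWalkBound (μ ^ 4) := fun t ht τ hτ =>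
    hX.hasWalkBound_link hκ.le hlam (by omega) hτ
  refine ⟨fun φ h0 hφ => ?_, fun φ h0 hφ hs => ⟨?_, ?_⟩, fun φ h0 hφ hs => ⟨?_, ?_⟩⟩
  · exact X.cnorm_d_vertices_pos (by omega) hκ.le (hW 0 (by norm_num))
      (by norm_num at hμ4 ⊢; linarith) h0 hφ
  · exact X.cnorm_d_edges (by omega) hκ.le hμ4 hκ.le hμ4 hμ7
      (fun t ht => hW t (by omega)) hφ hs
  · have := cnorm_pos h0
    positivity
  · have hε1 : ε ≤ 1 := by
      obtain ⟨σ, hσ⟩ := supp_nonempty h0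
      have hσ := X.supp_subset φ hσ
      obtain ⟨v, hv, hvc⟩ := Finset.exists_subset_card_eq (s := σ) (n := 1)
        (by rw [(mem_cells.mp hσ).2]; norm_num)
      have hv1 : v ∈ X.cells 1 := hvc ▸ mem_cells_of_subset hσ hv
      refine (hexp v hv1).trans (coboundaryExpansion_le_one _ ?_)
      change 1 + 1 < X.rank - v.card
      omega
    rw [min_eq_left hε1] at hμ
    exact X.cnorm_d_triangles (by omega) hε hε1 hμ hW hexp hφ hs
  · have := cnorm_pos h0
    positivity
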